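/- Let $M$ be a standard one-dimensional Brownian motion, $\mu\in\mathbb{R}$, $\rho\in[0,1)$, $\theta\in[0,1]$, $\sigma\in\mathbb{R}$, $T>0$ and $\lambda>0$, and assume $$\lambda\,\bigl[1-2(\theta-\rho\sigma-\rho^2)\bigr]<1 .$$ Let $$v(t,x)=\frac{1}{\sqrt{2\pi(1-\rho)t}}\exp\Bigl(-\frac{(x-\mu t-\sqrt{\rho}\,M_t)^2}{2(1-\rho)t}\Bigr),$$ the solution of the SPDE $\mathrm{d}v=-\mu v_x\,\mathrm{d}t+\tfrac12 v_{xx}\,\mathrm{d}t-\sqrt{\rho}\,v_x\,\mathrm{d}M_t$ on $\mathbb{R}$ with initial datum $v(0,\cdot)=\delta_0$; that is, $v(t,x)=u(t,x-\mu t-\sqrt\rho M_t)$, where $u$ solves $u_t=\tfrac12(1-\rho)u_{xx}$ with $u(0,\cdot)=\delta_0$. For an integer $N\ge 1$ put $k=T/N$, $h=\sqrt{k/\lambda}$ (so that $k/h^2=\lambda$ is fixed) and $Z_n=(M_{(n+1)k}-M_{nk})/\sqrt{k}$. With $(D_1w)_j=w_{j+1}-w_{j-1}$ and $(D_2w)_j=w_{j+1}-2w_j+w_{j-1}$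 for $w\in\mathbb{R}^{\mathbb{Z}}$, the $\theta$-$\sigma$ Milstein scheme is given by $V^0_j=h^{-1}\mathbf{1}_{\{j=0\}}$ and $$\begin{aligned}V^{n+1}=V^n&-\theta\Bigl(\frac{\mu k}{2h}D_1-\frac{k}{2h^2}D_2\Bigr)V^{n+1}-(1-\theta)\Bigl(\frac{\mu k}{2h}D_1-\frac{k}{2h^2}D_2\Bigr)V^{n}\\&-\sigma\frac{\rho k}{2h^2}D_2V^{n+1}-(1-\sigma)\frac{\rho k}{2h^2}D_2V^n-\frac{\sqrt{\rho k}\,Z_n}{2h}D_1V^n+\frac{\rho k Z_n^2}{2h^2}D_2V^n ,\end{aligned}$$ where $V^n\in\ell^2(\mathbb{Z})$ along every path, for every $n$. Then this scheme has a unique solution (a sequence of random grid functions) for every $N\ge1$, and it converges in mean square at time $T$: for the spatial norm $\|w\|=\bigl(h\sum_{j\in\mathbb{Z}}|w_j|^2\bigr)^{1/2}$, and also for $\|w\|=\sup_{j\in\mathbb{Z}}|w_j|$, $$\sqrt{\mathbb{E}\bigl[\|V^N-(v(T,jh))_{j\in\mathbb{Z}}\|^2\bigr]}\longrightarrow0\qquad(N\to\infty),$$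 and the left-hand side is $O(k)$ as $N\to\infty$ (equivalently $O(h^2)$), with a constant that may depend on $\mu,\rho,\theta,\sigma,T,\lambda$ but not on $N$. -/

import Mathlib

open MeasureTheory ProbabilityTheory Filter Topology
open scoped ENNReal NNReal

noncomputable section

namespace MilsteinSPDE

/-- First central difference operator on grid functions. -/
def D1 (w : ℤ → ℝ) (j : ℤ) : ℝ := w (j + 1) - w (j - 1)

/-- Second central difference operator on grid functions. -/
def D2 (w : ℤ → ℝ) (j : ℤ) : ℝ := w (j + 1) - 2 * w j + w (j - 1)

/-- The drift difference operator `(μ k / (2h)) D₁ - (k / (2h²)) D₂`. -/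
def driftOp (μ k h : ℝ) (w : ℤ → ℝ) (j : ℤ) : ℝ :=
  μ * k / (2 * h) * D1 w j - k / (2 * h ^ 2) * D2 w j

/-- Dirac initial datum at the grid point `0`, on a grid of mesh size `h`. -/
def diracGrid (h : ℝ) (j : ℤ) : ℝ := if j = 0 then 1 / h else 0

/-- One step of the `θ`-`σ` Milstein central difference scheme with time step `k`, mesh size `h`
and standardised Brownian increment `z`, leading from `w` to `w'` (on the whole grid). -/
def IsStep (μ ρ θ σ k h z : ℝ) (w w' : ℤ → ℝ) : Prop :=
  ∀ j : ℤ, w' j = w j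
    - θ * driftOp μ k h w' j - (1 - θ) * driftOp μ k h w j
    - σ * (ρ * k / (2 * h ^ 2)) * D2 w' j - (1 - σ) * (ρ * k / (2 * h ^ 2)) * D2 w j
    - Real.sqrt (ρ * k) * z / (2 * h) * D1 w j + ρ * k * z ^ 2 / (2 * h ^ 2) * D2 w j

variable {Ω : Type*}

/-- The standardised increment `Zₙ = (M_{(n+1)k} - M_{nk}) / √k`. -/
def increment (M : ℝ≥0 → Ω → ℝ) (k : ℝ≥0) (n : ℕ) (ω : Ω) : ℝ :=
  (M ((n + 1 : ℕ) * k) ω - M ((n : ℕ) * k) ω) / Real.sqrt k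

/-- `V n ω j` is the solution of the `θ`-`σ` Milstein scheme driven by `M`, with Dirac initial datum:
a sequence of random grid functions in `ℓ²(ℤ)` that satisfies the (in general implicit) recursion
along every path. -/
structure IsMilsteinScheme [MeasurableSpace Ω] (P : Measure Ω) (M : ℝ≥0 → Ω → ℝ)
    (μ ρ θ σ : ℝ) (k : ℝ≥0) (h : ℝ) (V : ℕ → Ω → ℤ → ℝ) : Prop where
  aemeasurable : ∀ n j, AEMeasurable (fun ω => V n ω j) P
  memℓp : ∀ n ω, Memℓp (V n ω) 2
  initial : ∀ ω, V 0 ω = diracGrid h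
  step : ∀ n ω, IsStep μ ρ θ σ k h (increment M k n ω) (V n ω) (V (n + 1) ω)

/-- The solution of `∂u/∂t = ½ (1 - ρ) ∂²u/∂x²` on the real line with `u(0, ·) = δ₀`. -/
def heatSol (ρ t x : ℝ) : ℝ :=
  (Real.sqrt (2 * Real.pi * ((1 - ρ) * t)))⁻¹ * Real.exp (-x ^ 2 / (2 * ((1 - ρ) * t)))

/-- `heatSol` solves the heat equation `∂u/∂t = ½ (1 - ρ) ∂²u/∂x²` for `t > 0`. -/
theorem heatSol_heat_equation {ρ t : ℝ} (hρ : ρ < 1) (ht : 0 < t) (x : ℝ) :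
    ∃ ux : ℝ → ℝ, ∃ uxx : ℝ, (∀ y, HasDerivAt (fun y => heatSol ρ t y) (ux y) y) ∧
      HasDerivAt ux uxx x ∧
      HasDerivAt (fun s => heatSol ρ s x) (1 / 2 * (1 - ρ) * uxx) t := by
  have ha : 0 < 1 - ρ := by linarith
  have hs : 0 < (1 - ρ) * t := by positivity
  have hx : ∀ y, HasDerivAt (fun y => heatSol ρ t y)
      (heatSol ρ t y * (-y / ((1 - ρ) * t))) y := by
    intro y
    have h1 : HasDerivAt (fun y : ℝ => -y ^ 2 / (2 * ((1 - ρ) * t)))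
        (-(2 * y) / (2 * ((1 - ρ) * t))) y := by
      simpa using ((hasDerivAt_pow 2 y).neg).div_const (2 * ((1 - ρ) * t))
    refine (h1.exp.const_mul _).congr_deriv ?_
    unfold heatSol
    field_simp
  refine ⟨_, _, hx, (hx x).mul (((hasDerivAt_id x).neg).div_const ((1 - ρ) * t)), ?_⟩
  have hq : HasDerivAt (fun s : ℝ => 2 * Real.pi * ((1 - ρ) * s)) (2 * Real.pi * (1 - ρ)) t := by
    simpa using (((hasDerivAt_id t).const_mul (1 - ρ)).const_mul (2 * Real.pi))
  have hq0 : 0 < 2 * Real.pi * ((1 - ρ) * t) := by positivity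
  have h2 := (hq.sqrt hq0.ne').inv (Real.sqrt_pos.2 hq0).ne'
  have hd : HasDerivAt (fun s : ℝ => 2 * ((1 - ρ) * s)) (2 * (1 - ρ)) t := by
    simpa using (((hasDerivAt_id t).const_mul (1 - ρ)).const_mul 2)
  have h3 := ((hasDerivAt_const t (-x ^ 2)).div hd (by positivity)).exp
  refine (h2.mul h3).congr_deriv ?_
  have hr : Real.sqrt (2 * Real.pi * ((1 - ρ) * t)) ^ 2 = 2 * Real.pi * ((1 - ρ) * t) :=
    Real.sq_sqrt hq0.le
  have hr0 := Real.sqrt_pos.2 hq0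
  unfold heatSol
  simp only [Pi.div_apply, Pi.inv_apply]
  rw [hr]
  generalize Real.exp (-x ^ 2 / (2 * ((1 - ρ) * t))) = e
  generalize Real.sqrt (2 * Real.pi * ((1 - ρ) * t)) = w at *
  generalize 1 - ρ = a at *
  field_simp
  ring

/-- `heatSol` has initial datum `δ₀`. -/
theorem heatSol_tendsto_dirac {ρ : ℝ} (hρ : ρ < 1) (g : BoundedContinuousFunction ℝ ℝ) :
    Tendsto (fun t => ∫ x, heatSol ρ t x * g x) (𝓝[>] 0) (𝓝 (g 0)) := by
  have key : ∀ t ∈ Set.Ioi (0 : ℝ), ∫ y, g (Real.sqrt ((1 - ρ) * t) * y) ∂(gaussianReal 0 1)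
      = ∫ x, heatSol ρ t x * g x := by
    intro t ht
    have hs : 0 < (1 - ρ) * t := mul_pos (by linarith) ht
    have hmap := gaussianReal_map_const_mul (μ := 0) (v := 1) (Real.sqrt ((1 - ρ) * t))
    have hint := integral_gaussianReal_eq_integral_smul (μ := 0)
      (v := NNReal.mk (Real.sqrt ((1 - ρ) * t) ^ 2) (sq_nonneg _) * 1) (f := fun x => g x) (by
        intro h
        have := congrArg NNReal.toReal h
        simp at this
        rw [Real.sqrt_eq_zero hs.le] at this
        exact hs.ne' this)
    rw [mul_zero] at hmap
    rw [← hmap, integral_map (by fun_prop) (by fun_prop)] at hint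
    rw [hint]
    congr 1
    ext x
    simp [gaussianPDFReal, heatSol, Real.sq_sqrt hs.le]
  refine Tendsto.congr' (eventually_nhdsWithin_of_forall key) ?_
  have hl : Tendsto (fun t => ∫ y, g (Real.sqrt ((1 - ρ) * t) * y) ∂(gaussianReal 0 1)) (𝓝[>] 0)
      (𝓝 (∫ _y, g 0 ∂(gaussianReal 0 1))) := by
    refine tendsto_integral_filter_of_dominated_convergence (fun _ => ‖g‖) ?_ ?_ ?_ ?_
    · exact Eventually.of_forall fun t => by fun_prop
    · exact Eventually.of_forall fun t => Eventually.of_forall fun y => g.norm_coe_le_norm _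
    · exact integrable_const _
    · refine Eventually.of_forall fun y => ?_
      have hc : Continuous fun t : ℝ => g (Real.sqrt ((1 - ρ) * t) * y) := by fun_prop
      have := (hc.tendsto 0).mono_left (nhdsWithin_le_nhds (s := Set.Ioi 0))
      simpa using this
  simpa using hl

/-- The solution `v(t, x) = u(t, x - μ t - √ρ M_t)` of the SPDE
`dv = -μ v_x dt + ½ v_xx dt - √ρ v_x dM_t` with `v(0, ·) = δ₀`. -/
def exactSol (M : ℝ≥0 → Ω → ℝ) (μ ρ : ℝ) (t : ℝ≥0) (x : ℝ) (ω : Ω) : ℝ :=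
  heatSol ρ t (x - μ * t - Real.sqrt ρ * M t ω)

/-- The function `f(ρ; θ, σ)` of the mean-square stability condition `(k / h²) f < 1`. -/
def stabFun (ρ θ σ : ℝ) : ℝ := 1 - 2 * (θ - ρ * σ - ρ ^ 2)

/-- The mesh size `h` with `k / h² = r`. -/
def meshSize (r : ℝ) (k : ℝ≥0) : ℝ := Real.sqrt (k / r)

/-- The spatial `L_p` norm of a grid function on the grid of mesh size `h`:
`(h ∑ⱼ |wⱼ|²)^{1/2}` for `p = 2` and `supⱼ |wⱼ|` for `p = ∞`. -/
def gridNorm (h : ℝ) (p : ℝ≥0∞) (w : ℤ → ℝ) : ℝ≥0∞ :=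
  eLpNorm w p (ENNReal.ofReal h • (Measure.count : Measure ℤ))

/-- The mean-square error `√(E ‖V^N - v(T, ·)‖²)` at time `T`, for a random grid function `W`
that approximates `v(T, ·)` on the grid of mesh size `h`. -/
def msError [MeasurableSpace Ω] (P : Measure Ω) (M : ℝ≥0 → Ω → ℝ) (μ ρ : ℝ) (T : ℝ≥0) (h : ℝ)
    (p : ℝ≥0∞) (W : Ω → ℤ → ℝ) : ℝ≥0∞ :=
  (∫⁻ ω, gridNorm h p (fun j => W ω j - exactSol M μ ρ T (j * h) ω) ^ 2 ∂P) ^ (1 / 2 : ℝ)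

end MilsteinSPDE

end

open MilsteinSPDE

/-!
The scheme and the equation are both diagonalised by the Fourier transform in space. On the grid,
the frequency `ξ ∈ [-π, π]` is multiplied in one step by a random factor
`C(ξ, Z) = B(ξ, Z) / A(ξ)` (`symC`), where `B` is quadratic in the standard Gaussian increment
`Z`; the exact flow multiplies the wave number `η = ξ / h` by `G(ξ, Z)` (`symG`), an exponential
of an affine function of `Z`.

*Consistency* (`symbol_consistency`, `exists_local_error_le`). In the small quantity
`δ = √k (1 + |η|)`, the difference `C - G` is of third order along every path, and its correlation
with `G` is of fourth order, because the mean of `C - G` is and `G - 1` is of first order. These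
bounds hold uniformly on `[-π, π]`, so that low and high frequencies need not be treated
separately.

*Stability* (`exists_integral_norm_symC_sq_le`). The defect `|A|² - E|B|²` can be computed
exactly: with `t = sin² (ξ / 2)` it is `4 (k / h²) t` times a convex combination, with weights
`1 - t` and `t`, of `1 - ρ` and `1 - (k / h²) f(ρ; θ, σ)`, up to a term of order `k`. The
stability condition therefore gives `E|C|² ≤ exp (-γ η² k)` for small `k`.

*Propagation* (`gram_error_le`, `exists_mode_error_le`). As the increments are independent, the
mean-square error of one frequency after `N` steps is `aᴺ - 2 Re cᴺ + gᴺ`, with `a = E|C|²`,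
`c = E[C conj G]` and `g = E|G|²`. A deterministic recursion for this expression turns consistency
and stability into the bound `K k² (1 + |η|)⁸ exp (-γ η² T)`, which is integrable in `η` with any
polynomial weight; this is what makes the Dirac initial datum harmless.

*Back to the grid* (`gridNorm_sq_le`, `norm_aliasedMode_sub_le`). Both spatial norms are bounded
by a weighted `L²` norm in `ξ`, by Parseval's identity and by the Cauchy–Schwarz inequality. By
Poisson summation, the restriction of the exact solution to the grid has as Fourier transform the
sum of the exact symbol over all aliases `ξ + 2πm`; those with `m ≠ 0` contribute `O(k)` with a
Gaussian weight.

The scheme is solved by the grid function with Fourier transform `h⁻¹ ∏ C(ξ, Zₘ)` (`schemeSol`),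
and uniqueness in `ℓ²(ℤ)` is an energy estimate for the implicit stencil
(`eq_zero_of_stencil_eq_zero`).
-/

noncomputable section

namespace MilsteinSPDE

/-! ### Elementary estimates -/

lemma norm_exp_sub_one_le_of_re_nonpos {w : ℂ} (hw : w.re ≤ 0) :
    ‖Complex.exp w - 1‖ ≤ 2 * ‖w‖ := by
  have h1 : ‖Complex.exp w‖ ≤ 1 := by rw [Complex.norm_exp]; exact Real.exp_le_one_iff.2 hw
  rcases le_total ‖w‖ 1 with h | h
  · exact Complex.norm_exp_sub_one_le h
  · have := norm_sub_le (Complex.exp w) 1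
    rw [norm_one] at this
    linarith

lemma norm_exp_sub_one_sub_id_le_of_re_nonpos {w : ℂ} (hw : w.re ≤ 0) :
    ‖Complex.exp w - 1 - w‖ ≤ 3 * ‖w‖ ^ 2 := by
  have h1 : ‖Complex.exp w‖ ≤ 1 := by rw [Complex.norm_exp]; exact Real.exp_le_one_iff.2 hw
  rcases le_total ‖w‖ 1 with h | h
  · have := Complex.norm_exp_sub_one_sub_id_le h
    nlinarith [sq_nonneg ‖w‖]
  · have h2 := norm_sub_le (Complex.exp w - 1) w
    have := norm_sub_le (Complex.exp w) 1
    rw [norm_one] at this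
    nlinarith

lemma norm_exp_sub_quadratic_le_of_re_nonpos {w : ℂ} (hw : w.re ≤ 0) :
    ‖Complex.exp w - 1 - w - w ^ 2 / 2‖ ≤ 4 * ‖w‖ ^ 3 := by
  have h1 : ‖Complex.exp w‖ ≤ 1 := by rw [Complex.norm_exp]; exact Real.exp_le_one_iff.2 hw
  rcases le_total ‖w‖ 1 with h | h
  · have := Complex.exp_bound h (n := 3) (by norm_num)
    simp only [Finset.sum_range_succ, Finset.sum_range_zero, Nat.factorial] at this
    norm_num at this
    rw [show Complex.exp w - 1 - w - w ^ 2 / 2 = Complex.exp w - (1 + w + w ^ 2 / 2) by ring]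
    nlinarith [pow_nonneg (norm_nonneg w) 3]
  · have h2 := norm_sub_le (Complex.exp w - 1 - w) (w ^ 2 / 2)
    have h3 := norm_sub_le (Complex.exp w - 1) w
    have h4 := norm_sub_le (Complex.exp w) 1
    rw [norm_one] at h4
    have h5 : ‖w ^ 2 / 2‖ = ‖w‖ ^ 2 / 2 := by simp
    have h6 : ‖w‖ ^ 2 ≤ ‖w‖ ^ 3 := pow_le_pow_right₀ h (by norm_num)
    have h7 : ‖w‖ ≤ ‖w‖ ^ 2 := by nlinarith
    linarith

lemma abs_two_sub_two_cos_sub_sq_le (x : ℝ) : |(2 - 2 * Real.cos x) - x ^ 2| ≤ 3 * |x| ^ 4 := by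
  rcases le_total |x| 1 with h | h
  · have := abs_le.1 (Real.cos_bound h)
    rw [abs_le]
    have h4 : 0 ≤ |x| ^ 4 := by positivity
    constructor <;> linarith
  · have h1 := Real.one_sub_sq_div_two_le_cos (x := x)
    have h2 := Real.cos_le_one x
    have h3 : x ^ 2 ≤ |x| ^ 4 := by
      rw [← sq_abs]; exact pow_le_pow_right₀ h (by norm_num)
    rw [abs_le]
    constructor <;> nlinarith [sq_nonneg x]

lemma abs_sin_sub_self_le (x : ℝ) : |Real.sin x - x| ≤ 2 * |x| ^ 3 := by
  rcases le_total |x| 1 with h | h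
  · have h1 := abs_le.1 (Real.sin_bound h)
    have h4 : |x| ^ 5 ≤ |x| ^ 3 :=
      pow_le_pow_of_le_one (abs_nonneg x) h (by norm_num)
    have h5 : |x ^ 3| = |x| ^ 3 := abs_pow x 3
    have h6 := abs_le.1 h5.le
    have : 0 ≤ |x| ^ 3 := by positivity
    rw [abs_le]
    constructor <;> linarith
  · have h1 := abs_sub (Real.sin x) x
    have h2 := Real.abs_sin_le_one x
    have h3 : |x| ≤ |x| ^ 3 := by
      simpa using pow_le_pow_right₀ h (show 1 ≤ 3 by norm_num)
    have h4 : 1 ≤ |x| ^ 3 := by linarith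
    linarith

/-! ### Fourier symbols of one time step -/

/-- Symbol of `-R² D₂`, where `R² = k / h²`. The Fourier transform of a grid function `w` is
`∑ⱼ wⱼ e^{ijξ}` throughout. -/
def symS (R ξ : ℝ) : ℝ := R ^ 2 * (2 - 2 * Real.cos ξ)

/-- Symbol of the difference operator `R / 2 · D₁`, up to the factor `-i`, where `R² = k / h²`. -/
def symY (R ξ : ℝ) : ℝ := R * Real.sin ξ

/-- Symbol of the operator acting on `V^{n+1}` in one step of the scheme, where `κ = √k` and
`R = √k / h`. -/
def symA (μ ρ θ σ R κ ξ : ℝ) : ℂ :=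
  1 + (((θ - σ * ρ) / 2 * symS R ξ : ℝ) : ℂ) - ((θ * μ * κ * symY R ξ : ℝ) : ℂ) * Complex.I

/-- Symbol of the operator acting on `V^n` in one step of the scheme with standardised Brownian
increment `z`. -/
def symB (μ ρ θ σ R κ ξ z : ℝ) : ℂ :=
  1 - ((symS R ξ / 2 * ((1 - θ) - (1 - σ) * ρ + ρ * z ^ 2) : ℝ) : ℂ)
    + ((symY R ξ * ((1 - θ) * μ * κ + Real.sqrt ρ * z) : ℝ) : ℂ) * Complex.I

/-- Amplification factor of one step of the scheme. -/
def symC (μ ρ θ σ R κ ξ z : ℝ) : ℂ := symB μ ρ θ σ R κ ξ z / symA μ ρ θ σ R κ ξ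

/-- Amplification factor of the exact flow over one time step. -/
def symG (μ ρ R κ ξ z : ℝ) : ℂ :=
  Complex.exp (((-(1 - ρ) / 2 * (R * ξ) ^ 2 : ℝ) : ℂ)
    + ((R * ξ * (μ * κ + Real.sqrt ρ * z) : ℝ) : ℂ) * Complex.I)

/-- Mean of `symB` over a standard Gaussian `z`. -/
def symBMean (μ ρ θ σ R κ ξ : ℝ) : ℂ :=
  1 - ((symS R ξ / 2 * ((1 - θ) + σ * ρ) : ℝ) : ℂ)
    + ((symY R ξ * ((1 - θ) * μ * κ) : ℝ) : ℂ) * Complex.I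

/-- Mean of `symG` over a standard Gaussian `z`. -/
def symGMean (μ R κ ξ : ℝ) : ℂ :=
  Complex.exp (((-(1 / 2) * (R * ξ) ^ 2 : ℝ) : ℂ) + ((R * ξ * (μ * κ) : ℝ) : ℂ) * Complex.I)

/-- The triples `(κ, ξ, z)` with `0 ≤ κ ≤ κ₀` and a frequency `ξ` in `[-π, π]`. -/
def symDomain (κ₀ : ℝ) : Set (ℝ × ℝ × ℝ) :=
  {p | 0 ≤ p.1 ∧ p.1 ≤ κ₀ ∧ |p.2.1| ≤ Real.pi}

/-- The small quantity `κ (1 + |η|)`, with `η = ξ / h`, in which the symbols are expanded. -/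
def symDelta (R κ ξ : ℝ) : ℝ := R * |ξ| + κ

open Asymptotics in
/-- Local consistency along every path: the scheme and the exact flow have symbols that agree up to
third order in `symDelta`, and in the mean up to fourth order. -/
theorem symbol_consistency (μ θ σ R κ₀ : ℝ) {ρ : ℝ} (hρ0 : 0 ≤ ρ) (hρ1 : ρ < 1) (hR : 0 < R) :
    ((fun p : ℝ × ℝ × ℝ => symB μ ρ θ σ R p.1 p.2.1 p.2.2
        - symA μ ρ θ σ R p.1 p.2.1 * symG μ ρ R p.1 p.2.1 p.2.2)
      =O[𝓟 (symDomain κ₀)] fun p => (1 + |p.2.2|) ^ 3 * symDelta R p.1 p.2.1 ^ 3) ∧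
    ((fun p : ℝ × ℝ × ℝ => symG μ ρ R p.1 p.2.1 p.2.2 - 1)
      =O[𝓟 (symDomain κ₀)] fun p => (1 + |p.2.2|) * symDelta R p.1 p.2.1) ∧
    ((fun p : ℝ × ℝ × ℝ => symBMean μ ρ θ σ R p.1 p.2.1
        - symA μ ρ θ σ R p.1 p.2.1 * symGMean μ R p.1 p.2.1)
      =O[𝓟 (symDomain κ₀)] fun p => symDelta R p.1 p.2.1 ^ 4) ∧
    ((fun p : ℝ × ℝ × ℝ => symA μ ρ θ σ R p.1 p.2.1)
      =O[𝓟 (symDomain κ₀)] fun _ => (1 : ℝ)) := by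
  set l := 𝓟 (symDomain κ₀) with hl
  set δ : ℝ × ℝ × ℝ → ℝ := fun p => symDelta R p.1 p.2.1 with hδ
  set m : ℝ × ℝ × ℝ → ℝ := fun p => 1 + |p.2.2| with hm
  have of_le : ∀ {f g : ℝ × ℝ × ℝ → ℝ} (c : ℝ), (∀ p ∈ symDomain κ₀, |f p| ≤ c * |g p|) →
      f =O[l] g := fun c h => isBigO_principal.2 ⟨c, h⟩
  have hδ0 : ∀ p ∈ symDomain κ₀, 0 ≤ δ p := fun p hp => by
    have := hp.1
    simp only [hδ, symDelta]; positivity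
  have hκδ : (fun p : ℝ × ℝ × ℝ => p.1) =O[l] δ := of_le 1 fun p hp => by
    rw [abs_of_nonneg (hδ0 p hp), abs_of_nonneg hp.1, one_mul]
    simp only [hδ, symDelta]
    have : 0 ≤ R * |p.2.1| := by positivity
    linarith
  have hξδ : (fun p : ℝ × ℝ × ℝ => p.2.1) =O[l] δ := of_le R⁻¹ fun p hp => by
    rw [abs_of_nonneg (hδ0 p hp), inv_mul_eq_div, le_div_iff₀ hR]
    simp only [hδ, symDelta]
    linarith [hp.1]
  have hδ1 : δ =O[l] fun _ => (1 : ℝ) := of_le (R * Real.pi + κ₀) fun p hp => by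
    rw [abs_of_nonneg (hδ0 p hp), abs_one, mul_one]
    simp only [hδ, symDelta]
    have := mul_le_mul_of_nonneg_left hp.2.2 hR.le
    linarith [hp.2.1]
  have hy : (fun p : ℝ × ℝ × ℝ => R * p.2.1) =O[l] δ := hξδ.const_mul_left R
  have hS : (fun p : ℝ × ℝ × ℝ => symS R p.2.1 - (R * p.2.1) ^ 2) =O[l] fun p => δ p ^ 4 := by
    refine IsBigO.trans (of_le (R ^ 2 * 3) fun p hp => ?_) (hξδ.pow 4)
    rw [symS, mul_pow, ← mul_sub, abs_mul, abs_of_nonneg (sq_nonneg R), abs_pow, mul_assoc]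
    gcongr
    exact abs_two_sub_two_cos_sub_sq_le _
  have hY : (fun p : ℝ × ℝ × ℝ => symY R p.2.1 - R * p.2.1) =O[l] fun p => δ p ^ 3 := by
    refine IsBigO.trans (of_le (R * 2) fun p hp => ?_) (hξδ.pow 3)
    rw [symY, ← mul_sub, abs_mul, abs_of_nonneg hR.le, abs_pow, mul_assoc]
    gcongr
    exact abs_sin_sub_self_le _
  have hz : (fun p : ℝ × ℝ × ℝ => p.2.2) =O[l] m := of_le 1 fun p hp => by
    simp only [hm]
    rw [abs_of_nonneg (by positivity : (0 : ℝ) ≤ 1 + |p.2.2|)]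
    linarith
  have h1m : (fun _ : ℝ × ℝ × ℝ => (1 : ℝ)) =O[l] m := of_le 1 fun p hp => by
    simp only [hm]
    rw [abs_of_nonneg (by positivity : (0 : ℝ) ≤ 1 + |p.2.2|), abs_one]
    linarith [abs_nonneg p.2.2]
  have hpow : ∀ {i j : ℕ}, i ≤ j → (fun p => δ p ^ j) =O[l] fun p => δ p ^ i := by
    intro i j hij
    obtain ⟨d, rfl⟩ := Nat.exists_eq_add_of_le hij
    have := (isBigO_refl (fun p => δ p ^ i) l).mul (hδ1.pow d)
    simpa [pow_add] using this
  have hmpow : ∀ {i j : ℕ}, i ≤ j → (fun p => m p ^ i) =O[l] fun p => m p ^ j := by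
    intro i j hij
    obtain ⟨d, rfl⟩ := Nat.exists_eq_add_of_le hij
    have := (isBigO_refl (fun p => m p ^ i) l).mul (h1m.pow d)
    simpa [pow_add] using this
  have hmix : ∀ {i j i' j' : ℕ}, i ≤ i' → j' ≤ j →
      (fun p => m p ^ i * δ p ^ j) =O[l] fun p => m p ^ i' * δ p ^ j' :=
    fun h h' => (hmpow h).mul (hpow h')
  -- the frequency-domain increments, and the deviation of the discrete from the exact symbols
  have hSδ : (fun p : ℝ × ℝ × ℝ => symS R p.2.1) =O[l] fun p => δ p ^ 2 := by
    have := (hS.trans (hpow (show 2 ≤ 4 by norm_num))).add (hy.pow 2)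
    simpa using this
  have hYδ : (fun p : ℝ × ℝ × ℝ => symY R p.2.1) =O[l] fun p => δ p := by
    have := (hY.trans (hpow (show 1 ≤ 3 by norm_num))).add (by simpa using hy)
    simpa using this
  have ofC : ∀ {f : ℝ × ℝ × ℝ → ℝ} {g : ℝ × ℝ × ℝ → ℝ}, f =O[l] g →
      (fun p => (f p : ℂ)) =O[l] g := fun h => Complex.isBigO_ofReal_left.2 h
  have ofI : ∀ {f : ℝ × ℝ × ℝ → ℝ} {g : ℝ × ℝ × ℝ → ℝ}, f =O[l] g →
      (fun p => (f p : ℂ) * Complex.I) =O[l] g := fun {f g} h => by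
    refine IsBigO.trans (IsBigO.of_bound 1 (Eventually.of_forall fun p => ?_)) h
    simp
  set u : ℝ × ℝ × ℝ → ℂ := fun p => symA μ ρ θ σ R p.1 p.2.1 - 1 with hu
  set u₀ : ℝ × ℝ × ℝ → ℂ := fun p => (((θ - σ * ρ) / 2 * (R * p.2.1) ^ 2 : ℝ) : ℂ)
    - ((θ * μ * p.1 * (R * p.2.1) : ℝ) : ℂ) * Complex.I with hu₀
  have huδ : u =O[l] fun p => δ p ^ 2 := by
    have h1 := ofC (hSδ.const_mul_left ((θ - σ * ρ) / 2))
    have h2 := ofI ((hκδ.const_mul_left (θ * μ)).mul hYδ)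
    refine (h1.sub (h2.congr_right fun p => (sq _).symm)).congr_left fun p => ?_
    simp only [hu, symA]; ring
  have huu : (fun p => u p - u₀ p) =O[l] fun p => δ p ^ 4 := by
    have h1 := ofC (hS.const_mul_left ((θ - σ * ρ) / 2))
    have h2 := ofI ((hκδ.const_mul_left (θ * μ)).mul hY)
    refine (h1.sub (h2.congr_right fun p => (pow_succ' _ 3).symm)).congr_left fun p => ?_
    simp only [hu, hu₀, symA]; push_cast; ring
  set v' : ℝ × ℝ × ℝ → ℂ := fun p => ((-(1 - ρ) / 2 * (R * p.2.1) ^ 2 : ℝ) : ℂ)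
    + ((μ * p.1 * (R * p.2.1) : ℝ) : ℂ) * Complex.I with hv'
  set q : ℝ × ℝ × ℝ → ℂ := fun p => ((Real.sqrt ρ * p.2.2 * (R * p.2.1) : ℝ) : ℂ) * Complex.I
    with hq
  have hv'δ : v' =O[l] fun p => δ p ^ 2 := by
    have h1 := ofC ((hy.pow 2).const_mul_left (-(1 - ρ) / 2))
    have h2 := ofI ((hκδ.const_mul_left μ).mul hy)
    exact h1.add (h2.congr_right fun p => (sq _).symm)
  have hqδ : q =O[l] fun p => m p * δ p := ofI ((hz.const_mul_left (Real.sqrt ρ)).mul hy)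
  set w : ℝ × ℝ × ℝ → ℂ := fun p => v' p + q p with hw
  have hwδ : w =O[l] fun p => m p * δ p := by
    refine IsBigO.add ?_ hqδ
    have := hv'δ.trans (by simpa using hmix (show 0 ≤ 1 by norm_num) (show 1 ≤ 2 by norm_num))
    simpa using this
  have hG : ∀ p, symG μ ρ R p.1 p.2.1 p.2.2 = Complex.exp (w p) := fun p => by
    simp only [symG, hw, hv', hq]; congr 1; push_cast; ring
  have hwre : ∀ p, (w p).re ≤ 0 := fun p => by
    simp [hw, hv', hq, -Complex.ofReal_mul, -Complex.ofReal_add, -Complex.ofReal_pow]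
    have : 0 ≤ (1 - ρ) / 2 * (R * p.2.1) ^ 2 := by
      have : 0 ≤ 1 - ρ := by linarith
      positivity
    nlinarith
  have hG1 : (fun p => Complex.exp (w p) - 1) =O[l] fun p => m p * δ p :=
    (IsBigO.of_bound 2 (Eventually.of_forall fun p =>
      norm_exp_sub_one_le_of_re_nonpos (hwre p))).trans hwδ
  have hG2 : (fun p => Complex.exp (w p) - 1 - w p - w p ^ 2 / 2) =O[l]
      fun p => m p ^ 3 * δ p ^ 3 := by
    have h := (hwδ.pow 3).congr_right fun p => mul_pow (m p) (δ p) 3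
    refine IsBigO.trans (IsBigO.of_bound 4 (Eventually.of_forall fun p => ?_)) h
    rw [norm_pow]
    exact norm_exp_sub_quadratic_le_of_re_nonpos (hwre p)
  set v : ℝ × ℝ × ℝ → ℂ := fun p => ((-(1 / 2) * (R * p.2.1) ^ 2 : ℝ) : ℂ)
    + ((R * p.2.1 * (μ * p.1) : ℝ) : ℂ) * Complex.I with hv
  have hvδ : v =O[l] fun p => δ p ^ 2 := by
    have h1 := ofC ((hy.pow 2).const_mul_left (-(1 / 2)))
    have h2 := ofI (hy.mul (hκδ.const_mul_left μ))
    exact h1.add (h2.congr_right fun p => (sq _).symm)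
  have hvre : ∀ p, (v p).re ≤ 0 := fun p => by
    simp [hv, -Complex.ofReal_mul, -Complex.ofReal_add, -Complex.ofReal_pow]
    positivity
  have hE1 : (fun p => Complex.exp (v p) - 1) =O[l] fun p => δ p ^ 2 :=
    (IsBigO.of_bound 2 (Eventually.of_forall fun p =>
      norm_exp_sub_one_le_of_re_nonpos (hvre p))).trans hvδ
  have hE2 : (fun p => Complex.exp (v p) - 1 - v p) =O[l] fun p => δ p ^ 4 := by
    have h := (hvδ.pow 2).congr_right fun p => (pow_mul (δ p) 2 2).symm
    refine IsBigO.trans (IsBigO.of_bound 3 (Eventually.of_forall fun p => ?_)) h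
    rw [norm_pow]
    exact norm_exp_sub_one_sub_id_le_of_re_nonpos (hvre p)
  have hsq : ((Real.sqrt ρ : ℝ) : ℂ) ^ 2 = ρ := by
    rw [← Complex.ofReal_pow, Real.sq_sqrt hρ0]
  refine ⟨?_, ?_, ?_, ?_⟩
  · -- deviation of `symB` caused by the replacement of `symS`, `symY` by `(R ξ)²`, `R ξ`
    have hB1 : (fun p : ℝ × ℝ × ℝ => (((symS R p.2.1 - (R * p.2.1) ^ 2) *
        (-(1 / 2) * ((1 - θ) - (1 - σ) * ρ + ρ * p.2.2 ^ 2)) : ℝ) : ℂ))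
        =O[l] fun p => m p ^ 3 * δ p ^ 3 := by
      have h1 : (fun p : ℝ × ℝ × ℝ => -(1 / 2) * ((1 - θ) - (1 - σ) * ρ + ρ * p.2.2 ^ 2))
          =O[l] fun p => m p ^ 3 := by
        refine IsBigO.const_mul_left (IsBigO.add ?_ ?_) _
        · have := (h1m.pow 3).const_mul_left ((1 - θ) - (1 - σ) * ρ)
          simpa using this
        · exact ((hz.pow 2).const_mul_left ρ).trans (hmpow (by norm_num))
      exact ofC (((hS.trans (hpow (show 3 ≤ 4 by norm_num))).mul h1).congr_right
        fun p => mul_comm _ _)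
    have hB2 : (fun p : ℝ × ℝ × ℝ => (((symY R p.2.1 - (R * p.2.1)) *
        ((1 - θ) * μ * p.1 + Real.sqrt ρ * p.2.2) : ℝ) : ℂ) * Complex.I)
        =O[l] fun p => m p ^ 3 * δ p ^ 3 := by
      have h1 : (fun p : ℝ × ℝ × ℝ => (1 - θ) * μ * p.1 + Real.sqrt ρ * p.2.2)
          =O[l] fun p => m p ^ 3 := by
        refine IsBigO.add ?_ ?_
        · have h2 := (hκδ.trans hδ1).const_mul_left ((1 - θ) * μ)
          have := h2.trans (by simpa using h1m.pow 3)
          simpa using this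
        · refine (hz.const_mul_left _).trans ?_
          simpa using hmpow (show 1 ≤ 3 by norm_num)
      exact ofI ((hY.mul h1).congr_right fun p => mul_comm _ _)
    have hB3 : (fun p => q p * v' p + v' p ^ 2 / 2) =O[l] fun p => m p ^ 3 * δ p ^ 3 := by
      refine IsBigO.add ?_ ?_
      · refine ((hqδ.mul hv'δ).congr_right fun p => ?_).trans
          (hmix (show 1 ≤ 3 by norm_num) (show 3 ≤ 3 by norm_num))
        ring
      · have h : (fun p => v' p ^ 2 / 2) =O[l] fun p => (δ p ^ 2) ^ 2 :=
          ((hv'δ.pow 2).const_mul_left (1 / 2 : ℂ)).congr_left fun p => by ring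
        refine (h.congr_right fun p => ?_).trans
          (hmix (show 0 ≤ 3 by norm_num) (show 3 ≤ 4 by norm_num))
        ring
    have hB4 : (fun p => u p * (Complex.exp (w p) - 1)) =O[l] fun p => m p ^ 3 * δ p ^ 3 := by
      refine ((huδ.mul hG1).congr_right fun p => ?_).trans
          (hmix (show 1 ≤ 3 by norm_num) (show 3 ≤ 3 by norm_num))
      ring
    have hB5 : (fun p => u p - u₀ p) =O[l] fun p => m p ^ 3 * δ p ^ 3 := by
      have := huu.trans (by simpa using hmix (show 0 ≤ 3 by norm_num) (show 3 ≤ 4 by norm_num))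
      simpa using this
    refine ((((hB1.add hB2).sub hB3).sub hG2).sub (hB4.add hB5)).congr_left fun p => ?_
    rw [hG p]
    have e1 : q p ^ 2 = -((ρ : ℂ) * p.2.2 ^ 2 * (R * p.2.1) ^ 2) := by
      simp only [hq]; push_cast
      rw [mul_pow, Complex.I_sq, mul_pow, mul_pow, hsq]; ring
    have e2 : symA μ ρ θ σ R p.1 p.2.1 = 1 + u p := by simp only [hu]; ring
    have e3 : symB μ ρ θ σ R p.1 p.2.1 p.2.2 =
        (((symS R p.2.1 - (R * p.2.1) ^ 2) *
        (-(1 / 2) * ((1 - θ) - (1 - σ) * ρ + ρ * p.2.2 ^ 2)) : ℝ) : ℂ)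
        + (((symY R p.2.1 - (R * p.2.1)) *
        ((1 - θ) * μ * p.1 + Real.sqrt ρ * p.2.2) : ℝ) : ℂ) * Complex.I
        + (1 + u₀ p + v' p + q p + q p ^ 2 / 2) := by
      rw [e1]; simp only [symB, hu₀, hv', hq]; push_cast; ring
    rw [e2, e3]
    simp only [hw]
    ring
  · exact hG1.congr_left fun p => by rw [hG p]
  · have hB1 := ofC (hS.mul (isBigO_const_const (-(1 / 2) * ((1 - θ) + σ * ρ))
      (one_ne_zero (α := ℝ)) l))
    have hB2 := ofI (hY.mul (hκδ.const_mul_left ((1 - θ) * μ)))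
    have hB4 := huδ.mul hE1
    refine (((((hB1.congr_right fun p => mul_one _).add (hB2.congr_right fun p =>
      (pow_succ _ 3).symm)).sub hE2).sub (hB4.congr_right fun p => ?_)).sub huu).congr_left
      fun p => ?_
    · ring
    · have e2 : symA μ ρ θ σ R p.1 p.2.1 = 1 + u p := by simp only [hu]; ring
      have e4 : symGMean μ R p.1 p.2.1 = Complex.exp (v p) := rfl
      rw [e2, e4]
      simp only [symBMean, hu₀, hv]
      push_cast
      ring
  · have h := (huδ.trans (hpow (show 0 ≤ 2 by norm_num))).congr_right (fun p => pow_zero _)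
    have h1 : (fun _ : ℝ × ℝ × ℝ => (1 : ℂ)) =O[l] fun _ => (1 : ℝ) :=
      isBigO_const_const _ one_ne_zero _
    exact (h1.add h).congr_left fun p => by simp only [hu]; ring

/-! ### Gaussian moments of the symbols -/

lemma integrable_one_add_abs_pow_gaussian (n : ℕ) :
    Integrable (fun z : ℝ => (1 + |z|) ^ n) (gaussianReal 0 1) := by
  have h : MemLp (fun z : ℝ => 1 + ‖z‖) n (gaussianReal 0 1) :=
    (memLp_const (1 : ℝ)).add (memLp_id_gaussianReal' (n : ℝ≥0∞) (by simp)).norm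
  refine h.integrable_norm_pow'.congr (ae_of_all _ fun z => ?_)
  have h0 : 0 ≤ 1 + |z| := by positivity
  simp only [Real.norm_eq_abs, abs_of_nonneg h0]

/-- The moments of order one, two and four of a standard Gaussian, read off from its moment
generating function `exp (t² / 2)`. -/
lemma gaussian_moments : ∫ z, z ∂(gaussianReal 0 1) = 0 ∧ ∫ z, z ^ 2 ∂(gaussianReal 0 1) = 1 ∧
    ∫ z, z ^ 4 ∂(gaussianReal 0 1) = 3 := by
  have h0 : ∀ n, iteratedDeriv n (mgf id (gaussianReal 0 1)) 0
      = ∫ z, z ^ n ∂(gaussianReal 0 1) := by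
    intro n
    rw [iteratedDeriv_mgf_zero]
    · simp
    · simp
  have hm : mgf id (gaussianReal 0 1) = fun t => Real.exp (t ^ 2 / 2) := by
    ext t
    simp [mgf_id_gaussianReal]
  have hd : ∀ t : ℝ, HasDerivAt (fun t => Real.exp (t ^ 2 / 2)) (t * Real.exp (t ^ 2 / 2)) t := by
    intro t
    have := ((hasDerivAt_pow 2 t).div_const 2).exp
    refine this.congr_deriv ?_
    simp; ring
  have hmul : ∀ {f : ℝ → ℝ} {f' t : ℝ}, HasDerivAt f f' t →
      deriv (fun t => f t * Real.exp (t ^ 2 / 2)) t = (f' + f t * t) * Real.exp (t ^ 2 / 2) := by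
    intro f f' t hf
    have : HasDerivAt (fun t => f t * Real.exp (t ^ 2 / 2))
        ((f' + f t * t) * Real.exp (t ^ 2 / 2)) t :=
      (hf.mul (hd t)).congr_deriv (by ring)
    exact this.deriv
  have d1 : deriv (fun t => Real.exp (t ^ 2 / 2)) = fun t => t * Real.exp (t ^ 2 / 2) :=
    funext fun t => (hd t).deriv
  have d2 : deriv (fun t => t * Real.exp (t ^ 2 / 2))
      = fun t => (1 + t ^ 2) * Real.exp (t ^ 2 / 2) := funext fun t => by
    rw [hmul (hasDerivAt_id' t)]; ring
  have d3 : deriv (fun t => (1 + t ^ 2) * Real.exp (t ^ 2 / 2))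
      = fun t => (3 * t + t ^ 3) * Real.exp (t ^ 2 / 2) := funext fun t => by
    rw [hmul ((hasDerivAt_pow 2 t).const_add 1)]; simp; ring
  have d4 : deriv (fun t => (3 * t + t ^ 3) * Real.exp (t ^ 2 / 2)) 0 = 3 := by
    have h : HasDerivAt (fun t : ℝ => 3 * t + t ^ 3) 3 0 :=
      (((hasDerivAt_id' (0 : ℝ)).const_mul 3).add (hasDerivAt_pow 3 0)).congr_deriv (by simp)
    rw [hmul h]; simp
  refine ⟨?_, ?_, ?_⟩
  · simp
  · simpa [hm, iteratedDeriv_succ, d1, d2] using (h0 2).symm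
  · simpa [hm, iteratedDeriv_succ, d1, d2, d3, d4] using (h0 4).symm

lemma integrable_pow_gaussian (n : ℕ) : Integrable (fun z : ℝ => z ^ n) (gaussianReal 0 1) := by
  refine (integrable_one_add_abs_pow_gaussian n).mono' (by fun_prop) (ae_of_all _ fun z => ?_)
  rw [norm_pow, Real.norm_eq_abs]
  gcongr
  linarith

lemma integrable_quartic_gaussian (a b c d : ℝ) :
    Integrable (fun z : ℝ => a + b * z + c * z ^ 2 + d * z ^ 4) (gaussianReal 0 1) := by
  have h1 : Integrable (fun z : ℝ => z) (gaussianReal 0 1) := by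
    simpa using integrable_pow_gaussian 1
  exact (((integrable_const a).add (h1.const_mul b)).add
    ((integrable_pow_gaussian 2).const_mul c)).add ((integrable_pow_gaussian 4).const_mul d)

lemma integral_quartic_gaussian (a b c d : ℝ) :
    ∫ z, a + b * z + c * z ^ 2 + d * z ^ 4 ∂(gaussianReal 0 1) = a + c + d * 3 := by
  obtain ⟨m1, m2, m4⟩ := gaussian_moments
  have i1 : Integrable (fun z : ℝ => a + b * z) (gaussianReal 0 1) := by
    simpa using integrable_quartic_gaussian a b 0 0
  have i2 : Integrable (fun z : ℝ => a + b * z + c * z ^ 2) (gaussianReal 0 1) := by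
    simpa using integrable_quartic_gaussian a b c 0
  have h1 : Integrable (fun z : ℝ => b * z) (gaussianReal 0 1) := by
    simpa using integrable_quartic_gaussian 0 b 0 0
  rw [integral_add i2 ((integrable_pow_gaussian 4).const_mul d),
    integral_add i1 ((integrable_pow_gaussian 2).const_mul c), integral_add (integrable_const a) h1,
    integral_const_mul, integral_const_mul, integral_const_mul, m1, m2, m4]
  simp

@[fun_prop]
lemma continuous_symB (μ ρ θ σ R κ ξ : ℝ) : Continuous (symB μ ρ θ σ R κ ξ) := by
  unfold symB; fun_prop

@[fun_prop]
lemma continuous_symG (μ ρ R κ ξ : ℝ) : Continuous (symG μ ρ R κ ξ) := by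
  unfold symG; fun_prop

@[fun_prop]
lemma continuous_symC (μ ρ θ σ R κ ξ : ℝ) : Continuous (symC μ ρ θ σ R κ ξ) := by
  unfold symC; fun_prop

lemma norm_symG_sq (μ ρ R κ ξ z : ℝ) :
    ‖symG μ ρ R κ ξ z‖ ^ 2 = Real.exp (-(1 - ρ) * (R * ξ) ^ 2) := by
  rw [symG, Complex.norm_exp, ← Real.exp_nat_mul]
  congr 1
  simp [-Complex.ofReal_mul, -Complex.ofReal_add, -Complex.ofReal_pow]
  ring

lemma norm_symG_le_one {ρ : ℝ} (hρ1 : ρ < 1) (μ R κ ξ z : ℝ) : ‖symG μ ρ R κ ξ z‖ ≤ 1 := by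
  rw [← sq_le_one_iff₀ (norm_nonneg _), norm_symG_sq]
  refine Real.exp_le_one_iff.2 ?_
  have := mul_nonneg (sub_nonneg.2 hρ1.le) (sq_nonneg (R * ξ))
  linarith

/-- Real and imaginary part of `symB` as polynomials in the Gaussian variable. -/
lemma symB_eq (μ ρ θ σ R κ ξ z : ℝ) : symB μ ρ θ σ R κ ξ z =
    (((1 - symS R ξ / 2 * ((1 - θ) - (1 - σ) * ρ)) + 0 * z + -(symS R ξ / 2 * ρ) * z ^ 2
      + 0 * z ^ 4 : ℝ) : ℂ)
    + ((symY R ξ * ((1 - θ) * μ * κ) + symY R ξ * Real.sqrt ρ * z + 0 * z ^ 2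
      + 0 * z ^ 4 : ℝ) : ℂ) * Complex.I := by
  unfold symB; push_cast; ring

lemma integrable_symB (μ ρ θ σ R κ ξ : ℝ) :
    Integrable (symB μ ρ θ σ R κ ξ) (gaussianReal 0 1) := by
  refine Integrable.congr ?_ (ae_of_all _ fun z => (symB_eq μ ρ θ σ R κ ξ z).symm)
  exact (integrable_quartic_gaussian _ _ _ _).ofReal.add
    ((integrable_quartic_gaussian _ _ _ _).ofReal.mul_const _)

lemma integral_symB {ρ : ℝ} (μ θ σ R κ ξ : ℝ) :
    ∫ z, symB μ ρ θ σ R κ ξ z ∂(gaussianReal 0 1) = symBMean μ ρ θ σ R κ ξ := by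
  simp_rw [symB_eq]
  rw [integral_add (integrable_quartic_gaussian _ _ _ _).ofReal
    ((integrable_quartic_gaussian _ _ _ _).ofReal.mul_const _), integral_mul_const,
    integral_complex_ofReal, integral_complex_ofReal, integral_quartic_gaussian,
    integral_quartic_gaussian, symBMean]
  push_cast
  ring

lemma integral_symG {ρ : ℝ} (hρ0 : 0 ≤ ρ) (μ R κ ξ : ℝ) :
    ∫ z, symG μ ρ R κ ξ z ∂(gaussianReal 0 1) = symGMean μ R κ ξ := by
  have h := charFun_gaussianReal (μ := 0) (v := 1) (R * ξ * Real.sqrt ρ)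
  rw [charFun_apply_real] at h
  have hsq : ((Real.sqrt ρ : ℝ) : ℂ) ^ 2 = ρ := by
    rw [← Complex.ofReal_pow, Real.sq_sqrt hρ0]
  have e : ∀ z : ℝ, symG μ ρ R κ ξ z = Complex.exp ((-(1 - ρ) / 2 * (R * ξ) ^ 2 : ℝ)
      + (R * ξ * (μ * κ) : ℝ) * Complex.I)
      * Complex.exp (((R * ξ * Real.sqrt ρ : ℝ) : ℂ) * z * Complex.I) := by
    intro z
    rw [symG, ← Complex.exp_add]
    congr 1
    push_cast; ring
  simp_rw [e]
  rw [integral_const_mul, h, symGMean, ← Complex.exp_add]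
  congr 1
  push_cast
  rw [mul_pow ((R : ℂ) * ξ), hsq]
  ring

lemma norm_symB_sq {ρ : ℝ} (hρ0 : 0 ≤ ρ) (μ θ σ R κ ξ z : ℝ) :
    ‖symB μ ρ θ σ R κ ξ z‖ ^ 2 =
      ((1 - symS R ξ / 2 * ((1 - θ) - (1 - σ) * ρ)) ^ 2 + (symY R ξ * ((1 - θ) * μ * κ)) ^ 2)
      + 2 * symY R ξ ^ 2 * ((1 - θ) * μ * κ) * Real.sqrt ρ * z
      + (symY R ξ ^ 2 * ρ
          - (1 - symS R ξ / 2 * ((1 - θ) - (1 - σ) * ρ)) * symS R ξ * ρ) * z ^ 2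
      + (symS R ξ / 2 * ρ) ^ 2 * z ^ 4 := by
  rw [Complex.sq_norm, Complex.normSq_apply, symB]
  simp [-Complex.ofReal_mul, -Complex.ofReal_add, -Complex.ofReal_sub, -Complex.ofReal_pow,
    -Complex.ofReal_div]
  have hsq := Real.sq_sqrt hρ0
  linear_combination (symY R ξ ^ 2 * z ^ 2) * hsq

lemma norm_symA_sq (μ ρ θ σ R κ ξ : ℝ) :
    ‖symA μ ρ θ σ R κ ξ‖ ^ 2 =
      (1 + (θ - σ * ρ) / 2 * symS R ξ) ^ 2 + (θ * μ * κ * symY R ξ) ^ 2 := by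
  rw [Complex.sq_norm, Complex.normSq_apply, symA]
  simp [-Complex.ofReal_mul, -Complex.ofReal_add, -Complex.ofReal_sub, -Complex.ofReal_pow,
    -Complex.ofReal_div]
  ring

lemma integrable_norm_symB_sq {ρ : ℝ} (hρ0 : 0 ≤ ρ) (μ θ σ R κ ξ : ℝ) :
    Integrable (fun z => ‖symB μ ρ θ σ R κ ξ z‖ ^ 2) (gaussianReal 0 1) := by
  simp_rw [norm_symB_sq hρ0]
  exact integrable_quartic_gaussian _ _ _ _

lemma integral_norm_symB_sq {ρ : ℝ} (hρ0 : 0 ≤ ρ) (μ θ σ R κ ξ : ℝ) :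
    ∫ z, ‖symB μ ρ θ σ R κ ξ z‖ ^ 2 ∂(gaussianReal 0 1) =
      ((1 - symS R ξ / 2 * ((1 - θ) - (1 - σ) * ρ)) ^ 2 + (symY R ξ * ((1 - θ) * μ * κ)) ^ 2)
      + (symY R ξ ^ 2 * ρ
          - (1 - symS R ξ / 2 * ((1 - θ) - (1 - σ) * ρ)) * symS R ξ * ρ)
      + (symS R ξ / 2 * ρ) ^ 2 * 3 := by
  simp_rw [norm_symB_sq hρ0]
  exact integral_quartic_gaussian _ _ _ _

/-! ### Mean-square stability -/

lemma symS_nonneg (R ξ : ℝ) : 0 ≤ symS R ξ := by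
  have := Real.cos_le_one ξ
  exact mul_nonneg (sq_nonneg R) (by linarith)

/-- The stability condition makes the implicit part of the scheme uniformly invertible. -/
lemma exists_le_re_symA {ρ θ σ R : ℝ} (hR : 0 < R) (hstab : R ^ 2 * stabFun ρ θ σ < 1) :
    ∃ c₀ > 0, ∀ μ κ ξ : ℝ, c₀ ≤ (symA μ ρ θ σ R κ ξ).re := by
  refine ⟨min 1 (R ^ 2), by positivity, fun μ κ ξ => ?_⟩
  have hre : (symA μ ρ θ σ R κ ξ).re = 1 + (θ - σ * ρ) / 2 * symS R ξ := by
    simp [symA, -Complex.ofReal_mul]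
  rw [hre, symS]
  have h1 := Real.cos_le_one ξ
  have h2 := Real.neg_one_le_cos ξ
  unfold stabFun at hstab
  -- an affine function of `(1 - cos ξ) / 2 ∈ [0, 1]`, bounded below at both end points
  have h3 : R ^ 2 ≤ 1 + 2 * R ^ 2 * (θ - σ * ρ) := by
    nlinarith [mul_nonneg (sq_nonneg R) (sq_nonneg ρ)]
  have h4 := min_le_left 1 (R ^ 2)
  have h5 := min_le_right 1 (R ^ 2)
  nlinarith

lemma le_norm_symA_of_le_re {μ ρ θ σ R κ ξ c : ℝ} (h : c ≤ (symA μ ρ θ σ R κ ξ).re) :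
    c ≤ ‖symA μ ρ θ σ R κ ξ‖ := h.trans (Complex.re_le_norm _)

/-- Mean-square stability of the scheme: for small time steps, the amplification factor of the
frequency `ξ` has mean square at most `exp (-γ (R ξ)²)`. -/
theorem exists_integral_norm_symC_sq_le (μ : ℝ) {ρ θ σ R : ℝ} (hρ0 : 0 ≤ ρ) (hρ1 : ρ < 1)
    (hθ : θ ∈ Set.Icc (0 : ℝ) 1) (hR : 0 < R) (hstab : R ^ 2 * stabFun ρ θ σ < 1) :
    ∃ γ > 0, ∃ κ₁ > 0, ∀ κ ξ : ℝ, 0 ≤ κ → κ ≤ κ₁ → |ξ| ≤ Real.pi →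
      ∫ z, ‖symC μ ρ θ σ R κ ξ z‖ ^ 2 ∂(gaussianReal 0 1) ≤ Real.exp (-γ * (R * ξ) ^ 2) := by
  obtain ⟨c₀, hc₀, hA⟩ := exists_le_re_symA hR hstab
  set m := min (1 - ρ) (1 - R ^ 2 * stabFun ρ θ σ) with hm
  have hm0 : 0 < m := lt_min (by linarith) (by linarith)
  set κ₁ := Real.sqrt (m / (2 * (μ ^ 2 + 1))) with hκ₁
  have hκ₁0 : 0 < κ₁ := Real.sqrt_pos.2 (by positivity)
  have hbig := (symbol_consistency μ θ σ R κ₁ hρ0 hρ1 hR).2.2.2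
  obtain ⟨A₁, hA₁⟩ := Asymptotics.isBigO_principal.1 hbig
  refine ⟨2 * m / (Real.pi ^ 2 * (A₁ ^ 2 + 1)), by positivity, κ₁, hκ₁0, fun κ ξ hκ0 hκ1 hξ => ?_⟩
  have hAle : ‖symA μ ρ θ σ R κ ξ‖ ^ 2 ≤ A₁ ^ 2 + 1 := by
    have := hA₁ (κ, ξ, 0) ⟨hκ0, hκ1, hξ⟩
    simp at this
    have h0 := norm_nonneg (symA μ ρ θ σ R κ ξ)
    nlinarith
  have hApos : 0 < ‖symA μ ρ θ σ R κ ξ‖ :=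
    hc₀.trans_le (le_norm_symA_of_le_re (hA μ κ ξ))
  have hκm : μ ^ 2 * κ ^ 2 ≤ m / 2 := by
    have h1 : κ ^ 2 ≤ m / (2 * (μ ^ 2 + 1)) := by
      rw [← Real.sq_sqrt (show 0 ≤ m / (2 * (μ ^ 2 + 1)) by positivity)]
      exact pow_le_pow_left₀ hκ0 hκ1 2
    rw [le_div_iff₀ (by positivity)] at h1
    nlinarith [sq_nonneg κ]
  have hYS : symY R ξ ^ 2 = symS R ξ * (1 - (1 - Real.cos ξ) / 2) := by
    unfold symY symS
    have := Real.sin_sq_add_cos_sq ξ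
    linear_combination R ^ 2 * this
  have hSt : symS R ξ = 4 * R ^ 2 * ((1 - Real.cos ξ) / 2) := by unfold symS; ring
  set t := (1 - Real.cos ξ) / 2 with ht
  have ht0 : 0 ≤ t := by have := Real.cos_le_one ξ; simp only [ht]; linarith
  have ht1 : t ≤ 1 := by have := Real.neg_one_le_cos ξ; simp only [ht]; linarith
  have hS0 := symS_nonneg R ξ
  have hSlow : 4 / Real.pi ^ 2 * (R * ξ) ^ 2 ≤ symS R ξ := by
    have := Real.cos_le_one_sub_mul_cos_sq hξ
    unfold symS
    have h2 : 4 / Real.pi ^ 2 * ξ ^ 2 ≤ 2 - 2 * Real.cos ξ := by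
      have : 4 / Real.pi ^ 2 * ξ ^ 2 = 2 * (2 / Real.pi ^ 2 * ξ ^ 2) := by ring
      linarith
    calc 4 / Real.pi ^ 2 * (R * ξ) ^ 2 = R ^ 2 * (4 / Real.pi ^ 2 * ξ ^ 2) := by ring
      _ ≤ _ := mul_le_mul_of_nonneg_left h2 (sq_nonneg R)
  -- the exact defect of the mean-square amplification factor
  have hdef : ‖symA μ ρ θ σ R κ ξ‖ ^ 2 - ∫ z, ‖symB μ ρ θ σ R κ ξ z‖ ^ 2 ∂(gaussianReal 0 1)
      = symS R ξ * ((1 - ρ) * (1 - t) + t * (1 - R ^ 2 * stabFun ρ θ σ)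
        + (1 - t) * (μ ^ 2 * κ ^ 2) * (2 * θ - 1)) := by
    rw [norm_symA_sq, integral_norm_symB_sq hρ0]
    unfold stabFun
    have e1 : symS R ξ ^ 2 = symS R ξ * (4 * R ^ 2 * t) := by rw [sq]; nth_rewrite 2 [hSt]; rfl
    have e2 : (θ * μ * κ * symY R ξ) ^ 2 = θ ^ 2 * μ ^ 2 * κ ^ 2 * symY R ξ ^ 2 := by ring
    have e3 : (symY R ξ * ((1 - θ) * μ * κ)) ^ 2
      = (1 - θ) ^ 2 * μ ^ 2 * κ ^ 2 * symY R ξ ^ 2 := by ring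
    rw [e2, e3, hYS]
    linear_combination ((θ - σ * ρ) ^ 2 / 4 - ((1 - θ) - (1 - σ) * ρ) ^ 2 / 4
      - ((1 - θ) - (1 - σ) * ρ) * ρ / 2 - 3 * ρ ^ 2 / 4) * e1
  have hdef2 : symS R ξ * (m / 2) ≤
      ‖symA μ ρ θ σ R κ ξ‖ ^ 2 - ∫ z, ‖symB μ ρ θ σ R κ ξ z‖ ^ 2 ∂(gaussianReal 0 1) := by
    rw [hdef]
    refine mul_le_mul_of_nonneg_left ?_ hS0
    have h1 : m * (1 - t) ≤ (1 - ρ) * (1 - t) :=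
      mul_le_mul_of_nonneg_right (min_le_left _ _) (by linarith)
    have h2 : t * m ≤ t * (1 - R ^ 2 * stabFun ρ θ σ) :=
      mul_le_mul_of_nonneg_left (min_le_right _ _) ht0
    have h3 : -(m / 2) ≤ (1 - t) * (μ ^ 2 * κ ^ 2) * (2 * θ - 1) := by
      have h4 : (1 - t) * (μ ^ 2 * κ ^ 2) ≤ m / 2 := by
        nlinarith [mul_nonneg (sq_nonneg μ) (sq_nonneg κ)]
      have h5 : 0 ≤ (1 - t) * (μ ^ 2 * κ ^ 2) := by
        have : 0 ≤ 1 - t := by linarith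
        positivity
      nlinarith [hθ.1, hθ.2]
    linarith
  have hquot : ∫ z, ‖symC μ ρ θ σ R κ ξ z‖ ^ 2 ∂(gaussianReal 0 1) =
      (∫ z, ‖symB μ ρ θ σ R κ ξ z‖ ^ 2 ∂(gaussianReal 0 1)) / ‖symA μ ρ θ σ R κ ξ‖ ^ 2 := by
    simp_rw [symC, norm_div, div_pow]
    rw [integral_div]
  rw [hquot]
  have hle : (∫ z, ‖symB μ ρ θ σ R κ ξ z‖ ^ 2 ∂(gaussianReal 0 1)) / ‖symA μ ρ θ σ R κ ξ‖ ^ 2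
      ≤ 1 - symS R ξ * (m / 2) / (A₁ ^ 2 + 1) := by
    have h1 : symS R ξ * (m / 2) / (A₁ ^ 2 + 1) ≤
        symS R ξ * (m / 2) / ‖symA μ ρ θ σ R κ ξ‖ ^ 2 := by gcongr
    have h2 : (∫ z, ‖symB μ ρ θ σ R κ ξ z‖ ^ 2 ∂(gaussianReal 0 1)) / ‖symA μ ρ θ σ R κ ξ‖ ^ 2
        ≤ 1 - symS R ξ * (m / 2) / ‖symA μ ρ θ σ R κ ξ‖ ^ 2 := by
      rw [div_le_iff₀ (by positivity), sub_mul, one_mul, div_mul_cancel₀ _ (by positivity)]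
      linarith
    linarith
  have hfin : 2 * m / (Real.pi ^ 2 * (A₁ ^ 2 + 1)) * (R * ξ) ^ 2
      ≤ symS R ξ * (m / 2) / (A₁ ^ 2 + 1) := by
    have : 2 * m / (Real.pi ^ 2 * (A₁ ^ 2 + 1)) * (R * ξ) ^ 2
        = (4 / Real.pi ^ 2 * (R * ξ) ^ 2) * (m / 2) / (A₁ ^ 2 + 1) := by
      field_simp; ring
    rw [this]
    gcongr
  have := Real.add_one_le_exp (-(2 * m / (Real.pi ^ 2 * (A₁ ^ 2 + 1))) * (R * ξ) ^ 2)
  linarith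

/-! ### Mean-square error of one frequency after one step and after many steps -/

lemma integrable_symC (μ ρ θ σ R κ ξ : ℝ) :
    Integrable (symC μ ρ θ σ R κ ξ) (gaussianReal 0 1) :=
  (integrable_symB μ ρ θ σ R κ ξ).div_const _

lemma integrable_symG {ρ : ℝ} (hρ1 : ρ < 1) (μ R κ ξ : ℝ) :
    Integrable (symG μ ρ R κ ξ) (gaussianReal 0 1) :=
  (integrable_const (1 : ℝ)).mono' (continuous_symG μ ρ R κ ξ).aestronglyMeasurable
    (ae_of_all _ fun z => norm_symG_le_one hρ1 μ R κ ξ z)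

lemma integrable_norm_symC_sq {ρ : ℝ} (hρ0 : 0 ≤ ρ) (μ θ σ R κ ξ : ℝ) :
    Integrable (fun z => ‖symC μ ρ θ σ R κ ξ z‖ ^ 2) (gaussianReal 0 1) := by
  simp_rw [symC, norm_div, div_pow]
  exact (integrable_norm_symB_sq hρ0 μ θ σ R κ ξ).div_const _

lemma integrable_norm_symG_sq (μ ρ R κ ξ : ℝ) :
    Integrable (fun z => ‖symG μ ρ R κ ξ z‖ ^ 2) (gaussianReal 0 1) := by
  simp_rw [norm_symG_sq]
  exact integrable_const _

lemma integrable_symC_mul_conj_symG {ρ : ℝ} (hρ1 : ρ < 1) (μ θ σ R κ ξ : ℝ) :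
    Integrable (fun z => symC μ ρ θ σ R κ ξ z * (starRingEnd ℂ) (symG μ ρ R κ ξ z))
      (gaussianReal 0 1) :=
  (integrable_symC μ ρ θ σ R κ ξ).mul_bdd (c := 1)
    (Complex.continuous_conj.comp (continuous_symG μ ρ R κ ξ)).aestronglyMeasurable
    (ae_of_all _ fun z => by simpa using norm_symG_le_one hρ1 μ R κ ξ z)

lemma norm_sub_sq_complex (x y : ℂ) :
    ‖x - y‖ ^ 2 = ‖x‖ ^ 2 - 2 * (x * (starRingEnd ℂ) y).re + ‖y‖ ^ 2 := by
  simp only [Complex.sq_norm, Complex.normSq_apply, Complex.sub_re, Complex.sub_im, Complex.mul_re,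
    Complex.conj_re, Complex.conj_im]
  ring

/-- Mean square of the amplification factor of the scheme. -/
def ampA (μ ρ θ σ R κ ξ : ℝ) : ℝ := ∫ z, ‖symC μ ρ θ σ R κ ξ z‖ ^ 2 ∂(gaussianReal 0 1)

/-- Correlation of the amplification factors of the scheme and of the exact flow. -/
def ampC (μ ρ θ σ R κ ξ : ℝ) : ℂ :=
  ∫ z, symC μ ρ θ σ R κ ξ z * (starRingEnd ℂ) (symG μ ρ R κ ξ z) ∂(gaussianReal 0 1)

/-- Mean square of the amplification factor of the exact flow. -/
def ampG (ρ R ξ : ℝ) : ℝ := Real.exp (-(1 - ρ) * (R * ξ) ^ 2)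

lemma integral_norm_symG_sq (μ ρ R κ ξ : ℝ) :
    ∫ z, ‖symG μ ρ R κ ξ z‖ ^ 2 ∂(gaussianReal 0 1) = ampG ρ R ξ := by
  simp_rw [norm_symG_sq]
  simp [ampG]

lemma integral_norm_symC_sub_symG_sq {ρ : ℝ} (hρ0 : 0 ≤ ρ) (hρ1 : ρ < 1) (μ θ σ R κ ξ : ℝ) :
    ∫ z, ‖symC μ ρ θ σ R κ ξ z - symG μ ρ R κ ξ z‖ ^ 2 ∂(gaussianReal 0 1) =
      ampA μ ρ θ σ R κ ξ - 2 * (ampC μ ρ θ σ R κ ξ).re + ampG ρ R ξ := by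
  have hi := integrable_symC_mul_conj_symG hρ1 μ θ σ R κ ξ
  have hre : Integrable (fun z => 2 * (symC μ ρ θ σ R κ ξ z *
      (starRingEnd ℂ) (symG μ ρ R κ ξ z)).re) (gaussianReal 0 1) := hi.re.const_mul 2
  have hsub : Integrable (fun z => ‖symC μ ρ θ σ R κ ξ z‖ ^ 2 - 2 * (symC μ ρ θ σ R κ ξ z *
      (starRingEnd ℂ) (symG μ ρ R κ ξ z)).re) (gaussianReal 0 1) :=
    (integrable_norm_symC_sq hρ0 μ θ σ R κ ξ).sub hre
  simp_rw [norm_sub_sq_complex]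
  rw [integral_add hsub
    (integrable_norm_symG_sq μ ρ R κ ξ), integral_sub (integrable_norm_symC_sq hρ0 μ θ σ R κ ξ) hre,
    integral_norm_symG_sq, integral_const_mul]
  congr 3
  exact integral_re hi

lemma norm_ampC_le {ρ : ℝ} (hρ0 : 0 ≤ ρ) (hρ1 : ρ < 1) (μ θ σ R κ ξ : ℝ) :
    ‖ampC μ ρ θ σ R κ ξ‖ ≤ (ampA μ ρ θ σ R κ ξ + ampG ρ R ξ) / 2 := by
  have hi := integrable_symC_mul_conj_symG hρ1 μ θ σ R κ ξ
  have h1 := integrable_norm_symC_sq hρ0 μ θ σ R κ ξ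
  have h2 := integrable_norm_symG_sq μ ρ R κ ξ
  calc ‖ampC μ ρ θ σ R κ ξ‖
      ≤ ∫ z, ‖symC μ ρ θ σ R κ ξ z * (starRingEnd ℂ) (symG μ ρ R κ ξ z)‖ ∂(gaussianReal 0 1) :=
        norm_integral_le_integral_norm _
    _ ≤ ∫ z, (‖symC μ ρ θ σ R κ ξ z‖ ^ 2 + ‖symG μ ρ R κ ξ z‖ ^ 2) / 2 ∂(gaussianReal 0 1) := by
        refine integral_mono hi.norm ((h1.add h2).div_const 2) fun z => ?_
        simp only [norm_mul, RCLike.norm_conj]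
        have := two_mul_le_add_sq ‖symC μ ρ θ σ R κ ξ z‖ ‖symG μ ρ R κ ξ z‖
        linarith
    _ = _ := by
        rw [integral_div, integral_add h1 h2, integral_norm_symG_sq]
        rfl

/-- Consistency of one time step in mean square: the weak error is of fourth order and the mean
square error of sixth order in `symDelta`. -/
theorem exists_local_error_le (μ κ₀ : ℝ) {ρ θ σ R : ℝ} (hρ0 : 0 ≤ ρ) (hρ1 : ρ < 1) (hR : 0 < R)
    (hstab : R ^ 2 * stabFun ρ θ σ < 1) :
    ∃ K ≥ 0, ∀ κ ξ : ℝ, 0 ≤ κ → κ ≤ κ₀ → |ξ| ≤ Real.pi →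
      ‖ampC μ ρ θ σ R κ ξ - ampG ρ R ξ‖ ≤ K * symDelta R κ ξ ^ 4 ∧
      ampA μ ρ θ σ R κ ξ - 2 * (ampC μ ρ θ σ R κ ξ).re + ampG ρ R ξ
        ≤ K * symDelta R κ ξ ^ 6 := by
  obtain ⟨c₀, hc₀, hA⟩ := exists_le_re_symA hR hstab
  obtain ⟨o1, o2, o3, -⟩ := symbol_consistency μ θ σ R κ₀ hρ0 hρ1 hR
  obtain ⟨K₁, hK₁, hB₁⟩ := o1.exists_nonneg
  obtain ⟨K₂, hK₂, hB₂⟩ := o2.exists_nonneg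
  obtain ⟨K₃, hK₃, hB₃⟩ := o3.exists_nonneg
  replace hB₁ := eventually_principal.1 hB₁.bound
  replace hB₂ := eventually_principal.1 hB₂.bound
  replace hB₃ := eventually_principal.1 hB₃.bound
  set m := fun n : ℕ => ∫ z, (1 + |z|) ^ n ∂(gaussianReal 0 1) with hm
  have hm0 : ∀ n, 0 ≤ m n := fun n => integral_nonneg fun z => by positivity
  refine ⟨K₃ / c₀ + K₁ / c₀ * K₂ * m 4 + (K₁ / c₀) ^ 2 * m 6, by
    have := hm0 4; have := hm0 6; positivity, fun κ ξ hκ0 hκ1 hξ => ?_⟩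
  set δ := symDelta R κ ξ with hδ
  have hδ0 : 0 ≤ δ := by simp only [hδ, symDelta]; positivity
  have hAc : c₀ ≤ ‖symA μ ρ θ σ R κ ξ‖ := le_norm_symA_of_le_re (hA μ κ ξ)
  have hA0 : symA μ ρ θ σ R κ ξ ≠ 0 := norm_pos_iff.1 (hc₀.trans_le hAc)
  have hCG : ∀ z, ‖symC μ ρ θ σ R κ ξ z - symG μ ρ R κ ξ z‖
      ≤ K₁ / c₀ * ((1 + |z|) ^ 3 * δ ^ 3) := fun z => by
    have h := hB₁ (κ, ξ, z) ⟨hκ0, hκ1, hξ⟩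
    have h0 : 0 ≤ (1 + |z|) ^ 3 * δ ^ 3 := by positivity
    simp only [← hδ, Real.norm_of_nonneg h0] at h
    have e : symC μ ρ θ σ R κ ξ z - symG μ ρ R κ ξ z =
        (symB μ ρ θ σ R κ ξ z - symA μ ρ θ σ R κ ξ * symG μ ρ R κ ξ z) / symA μ ρ θ σ R κ ξ := by
      rw [symC]; field_simp
    rw [e, norm_div, div_mul_eq_mul_div]
    exact div_le_div₀ (by positivity) h hc₀ hAc
  have hG1 : ∀ z, ‖symG μ ρ R κ ξ z - 1‖ ≤ K₂ * ((1 + |z|) * δ) := fun z => by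
    have h := hB₂ (κ, ξ, z) ⟨hκ0, hκ1, hξ⟩
    have h0 : 0 ≤ (1 + |z|) * δ := by positivity
    simpa only [← hδ, Real.norm_of_nonneg h0] using h
  have iC := integrable_symC μ ρ θ σ R κ ξ
  have iG := integrable_symG hρ1 μ R κ ξ
  have iCG := integrable_symC_mul_conj_symG hρ1 μ θ σ R κ ξ
  have iGG : Integrable (fun z => symG μ ρ R κ ξ z * (starRingEnd ℂ) (symG μ ρ R κ ξ z))
      (gaussianReal 0 1) := iG.mul_bdd (c := 1)
    (Complex.continuous_conj.comp (continuous_symG μ ρ R κ ξ)).aestronglyMeasurable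
    (ae_of_all _ fun z => by simpa using norm_symG_le_one hρ1 μ R κ ξ z)
  constructor
  · have hg : ∫ z, symG μ ρ R κ ξ z * (starRingEnd ℂ) (symG μ ρ R κ ξ z) ∂(gaussianReal 0 1)
        = (ampG ρ R ξ : ℂ) := by
      simp_rw [Complex.mul_conj', ← Complex.ofReal_pow, norm_symG_sq]
      simp [ampG]
    -- split `E[(C - G) conj G] = E[C - G] + E[(C - G) conj (G - 1)]`
    have hsplit : ampC μ ρ θ σ R κ ξ - ampG ρ R ξ =
        (∫ z, symC μ ρ θ σ R κ ξ z - symG μ ρ R κ ξ z ∂(gaussianReal 0 1)) +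
        ∫ z, (symC μ ρ θ σ R κ ξ z - symG μ ρ R κ ξ z)
          * (starRingEnd ℂ) (symG μ ρ R κ ξ z - 1) ∂(gaussianReal 0 1) := by
      have iX : Integrable (fun z => symC μ ρ θ σ R κ ξ z - symG μ ρ R κ ξ z)
        (gaussianReal 0 1) := iC.sub iG
      have iY : Integrable (fun z => (symC μ ρ θ σ R κ ξ z - symG μ ρ R κ ξ z)
          * (starRingEnd ℂ) (symG μ ρ R κ ξ z - 1)) (gaussianReal 0 1) := by
        refine ((iCG.sub iGG).sub (iC.sub iG)).congr (ae_of_all _ fun z => ?_)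
        simp only [Pi.sub_apply, map_sub, map_one]; ring
      rw [← hg, ampC, ← integral_sub iCG iGG, ← integral_add iX iY]
      congr 1 with z
      simp only [map_sub, map_one]; ring
    have hmean : ‖∫ z, symC μ ρ θ σ R κ ξ z - symG μ ρ R κ ξ z ∂(gaussianReal 0 1)‖
        ≤ K₃ / c₀ * δ ^ 4 := by
      have h := hB₃ (κ, ξ, 0) ⟨hκ0, hκ1, hξ⟩
      have h0 : 0 ≤ δ ^ 4 := by positivity
      simp only [← hδ, Real.norm_of_nonneg h0] at h
      have e : ∫ z, symC μ ρ θ σ R κ ξ z - symG μ ρ R κ ξ z ∂(gaussianReal 0 1) =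
          (symBMean μ ρ θ σ R κ ξ - symA μ ρ θ σ R κ ξ * symGMean μ R κ ξ)
            / symA μ ρ θ σ R κ ξ := by
        rw [integral_sub iC iG, integral_symG hρ0]
        simp only [symC]
        rw [integral_div, integral_symB]
        field_simp
      rw [e, norm_div, div_mul_eq_mul_div]
      exact div_le_div₀ (by positivity) h hc₀ hAc
    have hcross : ‖∫ z, (symC μ ρ θ σ R κ ξ z - symG μ ρ R κ ξ z)
          * (starRingEnd ℂ) (symG μ ρ R κ ξ z - 1) ∂(gaussianReal 0 1)‖
        ≤ K₁ / c₀ * K₂ * m 4 * δ ^ 4 := by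
      have hb : ∀ z, ‖(symC μ ρ θ σ R κ ξ z - symG μ ρ R κ ξ z)
          * (starRingEnd ℂ) (symG μ ρ R κ ξ z - 1)‖
          ≤ (K₁ / c₀ * K₂ * δ ^ 4) * (1 + |z|) ^ 4 := fun z => by
        rw [norm_mul, RCLike.norm_conj]
        calc _ ≤ (K₁ / c₀ * ((1 + |z|) ^ 3 * δ ^ 3)) * (K₂ * ((1 + |z|) * δ)) :=
              mul_le_mul (hCG z) (hG1 z) (norm_nonneg _) (by positivity)
          _ = _ := by ring
      refine (norm_integral_le_of_norm_le
        ((integrable_one_add_abs_pow_gaussian 4).const_mul _) (ae_of_all _ hb)).trans_eq ?_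
      rw [integral_const_mul]
      ring
    have hm6 := hm0 6
    calc ‖ampC μ ρ θ σ R κ ξ - ampG ρ R ξ‖
        ≤ K₃ / c₀ * δ ^ 4 + K₁ / c₀ * K₂ * m 4 * δ ^ 4 := by
          rw [hsplit]; exact (norm_add_le _ _).trans (add_le_add hmean hcross)
      _ = (K₃ / c₀ + K₁ / c₀ * K₂ * m 4) * δ ^ 4 := by ring
      _ ≤ _ := by
          refine mul_le_mul_of_nonneg_right ?_ (by positivity)
          have : 0 ≤ (K₁ / c₀) ^ 2 * m 6 := by positivity
          linarith
  · rw [← integral_norm_symC_sub_symG_sq hρ0 hρ1]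
    have hm4 := hm0 4
    calc ∫ z, ‖symC μ ρ θ σ R κ ξ z - symG μ ρ R κ ξ z‖ ^ 2 ∂(gaussianReal 0 1)
        ≤ ∫ z, ((K₁ / c₀) ^ 2 * δ ^ 6) * (1 + |z|) ^ 6 ∂(gaussianReal 0 1) := by
          refine integral_mono_of_nonneg (ae_of_all _ fun z => by positivity)
            ((integrable_one_add_abs_pow_gaussian 6).const_mul _) (ae_of_all _ fun z => ?_)
          calc _ ≤ (K₁ / c₀ * ((1 + |z|) ^ 3 * δ ^ 3)) ^ 2 :=
                pow_le_pow_left₀ (norm_nonneg _) (hCG z) 2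
            _ = _ := by ring
      _ = ((K₁ / c₀) ^ 2 * m 6) * δ ^ 6 := by rw [integral_const_mul]; ring
      _ ≤ _ := by
          refine mul_le_mul_of_nonneg_right ?_ (by positivity)
          have : 0 ≤ K₃ / c₀ + K₁ / c₀ * K₂ * m 4 := by positivity
          linarith

/-- Error propagation. With `a`, `g` the mean squares of two amplification factors and `c` their
correlation, `eₙ = aⁿ - 2 Re cⁿ + gⁿ` is the mean-square difference of products of `n` independent
copies, and `eₙ₊₁ = a eₙ + 2 Re ((a - c) (cⁿ - gⁿ)) + gⁿ (a - 2 Re c + g)`. -/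
lemma gram_error_le {a g q q₀ β ε : ℝ} {c : ℂ} (ha0 : 0 ≤ a) (ha : a ≤ q) (hg0 : 0 ≤ g)
    (hg : g ≤ q) (hc : ‖c‖ ≤ q) (hq₀ : 0 < q₀) (hq : q₀ ≤ q) (hβ : ‖c - g‖ ≤ β)
    (hε0 : 0 ≤ a - 2 * c.re + g) (hε : a - 2 * c.re + g ≤ ε) (N : ℕ) :
    a ^ N - 2 * (c ^ N).re + g ^ N ≤
      N * q ^ N * (2 * (ε + β) * N * β / q₀ ^ 2 + ε / q₀) := by
  have hβ0 : 0 ≤ β := (norm_nonneg _).trans hβ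
  have hε0' : 0 ≤ ε := hε0.trans hε
  have hq0 : 0 < q := hq₀.trans_le hq
  -- the factor `q₀ ≤ q` avoids the exponent `n - 1`
  have hpow : ∀ n : ℕ, ‖c ^ n - (g : ℂ) ^ n‖ * q₀ ≤ n * q ^ n * β := by
    intro n
    induction n with
    | zero => simp
    | succ n ih =>
      have e : c ^ (n + 1) - (g : ℂ) ^ (n + 1)
          = c * (c ^ n - (g : ℂ) ^ n) + (c - g) * (g : ℂ) ^ n := by
        ring
      have h1 : ‖c ^ (n + 1) - (g : ℂ) ^ (n + 1)‖ ≤ q * ‖c ^ n - (g : ℂ) ^ n‖ + β * q ^ n := by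
        rw [e]
        refine (norm_add_le _ _).trans (add_le_add ?_ ?_)
        · rw [norm_mul]; gcongr
        · rw [norm_mul, norm_pow, Complex.norm_real, Real.norm_of_nonneg hg0]; gcongr
      calc ‖c ^ (n + 1) - (g : ℂ) ^ (n + 1)‖ * q₀
          ≤ (q * ‖c ^ n - (g : ℂ) ^ n‖ + β * q ^ n) * q₀ := by gcongr
        _ = q * (‖c ^ n - (g : ℂ) ^ n‖ * q₀) + β * q ^ n * q₀ := by ring
        _ ≤ q * (n * q ^ n * β) + β * q ^ n * q := by gcongr
        _ = _ := by push_cast; ring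
  have hac : ‖(a : ℂ) - c‖ ≤ ε + β := by
    have e : (a : ℂ) - c = ((a - 2 * c.re + g : ℝ) : ℂ) + (starRingEnd ℂ) (c - g) := by
      apply Complex.ext <;> simp; ring
    rw [e]
    refine (norm_add_le _ _).trans (add_le_add ?_ ?_)
    · rwa [Complex.norm_real, Real.norm_of_nonneg hε0]
    · rwa [RCLike.norm_conj]
  set W := 2 * (ε + β) * N * β / q₀ ^ 2 + ε / q₀ with hW
  have hW0 : 0 ≤ W := by positivity
  have main : ∀ n : ℕ, n ≤ N → a ^ n - 2 * (c ^ n).re + g ^ n ≤ n * q ^ n * W := by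
    intro n
    induction n with
    | zero => intro _; simp; norm_num
    | succ n ih =>
      intro hn
      have ih' := ih (by omega)
      have e : a ^ (n + 1) - 2 * (c ^ (n + 1)).re + g ^ (n + 1) =
          a * (a ^ n - 2 * (c ^ n).re + g ^ n) + 2 * (((a : ℂ) - c) * (c ^ n - (g : ℂ) ^ n)).re
            + g ^ n * (a - 2 * c.re + g) := by
        have hgr : (g : ℂ) ^ n = ((g ^ n : ℝ) : ℂ) := by push_cast; rfl
        rw [pow_succ c n, hgr]
        simp only [Complex.mul_re, Complex.sub_re, Complex.sub_im, Complex.ofReal_re,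
          Complex.ofReal_im]
        ring
      have h1 : (((a : ℂ) - c) * (c ^ n - (g : ℂ) ^ n)).re ≤
          (ε + β) * (n * q ^ n * β / q₀) := by
        refine (Complex.re_le_norm _).trans ?_
        rw [norm_mul]
        have := hpow n
        rw [← le_div_iff₀ hq₀] at this
        gcongr
      have hqn : q ^ n ≤ q ^ (n + 1) / q₀ := by
        rw [le_div_iff₀ hq₀, pow_succ]; gcongr
      have hnN : (n : ℝ) ≤ N := by exact_mod_cast (by omega : n ≤ N)
      rw [e]
      calc _ ≤ q * (n * q ^ n * W) + 2 * ((ε + β) * (N * (q ^ (n + 1) / q₀) * β / q₀))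
            + q ^ (n + 1) / q₀ * ε := by
            have h2 : (ε + β) * (n * q ^ n * β / q₀) ≤
                (ε + β) * (N * (q ^ (n + 1) / q₀) * β / q₀) := by gcongr
            have h3 : g ^ n * (a - 2 * c.re + g) ≤ q ^ (n + 1) / q₀ * ε := by
              refine mul_le_mul ((pow_le_pow_left₀ hg0 hg n).trans hqn) hε hε0 (by positivity)
            have h4 : a * (a ^ n - 2 * (c ^ n).re + g ^ n) ≤ q * (n * q ^ n * W) :=
              (mul_le_mul_of_nonneg_left ih' ha0).trans
                (mul_le_mul_of_nonneg_right ha (by positivity))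
            linarith
        _ = _ := by simp only [hW]; push_cast; field_simp; ring
  exact main N le_rfl

/-- Mean-square error of one frequency at the final time, in terms of the physical wave number
`η = R ξ / κ = ξ / h`. -/
theorem exists_mode_error_le (μ : ℝ) {ρ θ σ R T : ℝ} (hρ0 : 0 ≤ ρ) (hρ1 : ρ < 1)
    (hθ : θ ∈ Set.Icc (0 : ℝ) 1) (hR : 0 < R) (hstab : R ^ 2 * stabFun ρ θ σ < 1) (hT : 0 ≤ T) :
    ∃ K ≥ 0, ∃ γ > 0, ∃ κ₁ > 0, ∀ (N : ℕ) (κ ξ : ℝ), 0 < κ → κ ≤ κ₁ → N * κ ^ 2 = T →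
      |ξ| ≤ Real.pi →
      ampA μ ρ θ σ R κ ξ ^ N - 2 * (ampC μ ρ θ σ R κ ξ ^ N).re + ampG ρ R ξ ^ N ≤
        K * κ ^ 4 * ((1 + |R * ξ / κ|) ^ 8 * Real.exp (-γ * (R * ξ / κ) ^ 2 * T)) := by
  obtain ⟨γ', hγ', κ₁, hκ₁, hstep⟩ := exists_integral_norm_symC_sq_le μ hρ0 hρ1 hθ hR hstab
  obtain ⟨K, hK, hloc⟩ := exists_local_error_le μ κ₁ hρ0 hρ1 hR hstab
  set γ := min γ' (1 - ρ) with hγ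
  have hγ0 : 0 < γ := lt_min hγ' (by linarith)
  set q₀ := Real.exp (-γ * (R * Real.pi) ^ 2) with hq₀
  have hq₀0 : 0 < q₀ := Real.exp_pos _
  set Δ := R * Real.pi + κ₁ with hΔ
  refine ⟨2 * K ^ 2 * (Δ ^ 2 + 1) / q₀ ^ 2 * T ^ 2 + K / q₀ * T, by positivity, γ, hγ0, κ₁, hκ₁,
    fun N κ ξ hκ hκ1 hN hξ => ?_⟩
  obtain ⟨h4, h6⟩ := hloc κ ξ hκ.le hκ1 hξ
  set q := Real.exp (-γ * (R * ξ) ^ 2) with hq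
  have ha0 : 0 ≤ ampA μ ρ θ σ R κ ξ := integral_nonneg fun z => by positivity
  have ha : ampA μ ρ θ σ R κ ξ ≤ q := (hstep κ ξ hκ.le hκ1 hξ).trans <| Real.exp_le_exp.2 <| by
    have := mul_le_mul_of_nonneg_right (min_le_left γ' (1 - ρ)) (sq_nonneg (R * ξ))
    rw [← hγ] at this; linarith
  have hg0 : 0 ≤ ampG ρ R ξ := (Real.exp_pos _).le
  have hg : ampG ρ R ξ ≤ q := Real.exp_le_exp.2 <| by
    have := mul_le_mul_of_nonneg_right (min_le_right γ' (1 - ρ)) (sq_nonneg (R * ξ))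
    rw [← hγ] at this; linarith
  have hc : ‖ampC μ ρ θ σ R κ ξ‖ ≤ q := by
    have := norm_ampC_le hρ0 hρ1 μ θ σ R κ ξ
    linarith
  have hqq : q₀ ≤ q := Real.exp_le_exp.2 <| by
    have h1 : (R * ξ) ^ 2 ≤ (R * Real.pi) ^ 2 := by
      rw [mul_pow, mul_pow, ← sq_abs ξ]; gcongr
    nlinarith
  have hε0 : 0 ≤ ampA μ ρ θ σ R κ ξ - 2 * (ampC μ ρ θ σ R κ ξ).re + ampG ρ R ξ := by
    rw [← integral_norm_symC_sub_symG_sq hρ0 hρ1]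
    exact integral_nonneg fun z => by positivity
  refine (gram_error_le ha0 ha hg0 hg hc hq₀0 hqq h4 hε0 h6 N).trans ?_
  set η := R * ξ / κ with hη
  set δ := symDelta R κ ξ with hδ
  have hδη : δ = κ * (1 + |η|) := by
    simp only [hδ, symDelta, hη, abs_div, abs_mul, abs_of_pos hR, abs_of_pos hκ]
    field_simp; ring
  have hδ0 : 0 ≤ δ := by rw [hδη]; positivity
  have hδΔ : δ ≤ Δ := by
    simp only [hδ, symDelta, hΔ]; gcongr
  have hqN : q ^ N = Real.exp (-γ * η ^ 2 * T) := by
    rw [hq, ← Real.exp_nat_mul, ← hN]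
    congr 1
    simp only [hη]; field_simp
  rw [hqN]
  set E := Real.exp (-γ * η ^ 2 * T) with hE
  have hE0 : 0 < E := Real.exp_pos _
  have hεβ : K * δ ^ 6 + K * δ ^ 4 ≤ K * (Δ ^ 2 + 1) * δ ^ 4 := by
    have : δ ^ 2 ≤ Δ ^ 2 := pow_le_pow_left₀ hδ0 hδΔ 2
    calc K * δ ^ 6 + K * δ ^ 4 = K * (δ ^ 2 + 1) * δ ^ 4 := by ring
      _ ≤ _ := by gcongr
  have h68 : (1 + |η|) ^ 6 ≤ (1 + |η|) ^ 8 :=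
    pow_le_pow_right₀ (by linarith [abs_nonneg η]) (by norm_num)
  calc N * E * (2 * (K * δ ^ 6 + K * δ ^ 4) * N * (K * δ ^ 4) / q₀ ^ 2 + K * δ ^ 6 / q₀)
      ≤ N * E * (2 * (K * (Δ ^ 2 + 1) * δ ^ 4) * N * (K * δ ^ 4) / q₀ ^ 2 + K * δ ^ 6 / q₀) := by
        gcongr
    _ = (2 * K ^ 2 * (Δ ^ 2 + 1) / q₀ ^ 2 * (N * κ ^ 2) ^ 2 * (1 + |η|) ^ 8
          + K / q₀ * (N * κ ^ 2) * (1 + |η|) ^ 6) * κ ^ 4 * E := by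
        rw [hδη]; field_simp
    _ ≤ (2 * K ^ 2 * (Δ ^ 2 + 1) / q₀ ^ 2 * (N * κ ^ 2) ^ 2 * (1 + |η|) ^ 8
          + K / q₀ * (N * κ ^ 2) * (1 + |η|) ^ 8) * κ ^ 4 * E := by
        gcongr
    _ = _ := by rw [hN]; ring

/-! ### Grid functions with a given Fourier transform -/

/-- The grid function `j ↦ (2π)⁻¹ ∫ e^{-ijξ} f(ξ) dξ`, the integral being over `[-π, π]`. -/
def gridCoeff (f : ℝ → ℂ) (j : ℤ) : ℂ := fourierCoeffOn (neg_lt_self Real.pi_pos) f j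

lemma gridCoeff_eq (f : ℝ → ℂ) (j : ℤ) : gridCoeff f j =
    (1 / (2 * Real.pi) : ℝ) •
      ∫ ξ in -Real.pi..Real.pi, Complex.exp (-(j * ξ) * Complex.I) * f ξ := by
  rw [gridCoeff, fourierCoeffOn_eq_integral]
  congr 1
  · ring
  · refine intervalIntegral.integral_congr fun ξ _ => ?_
    simp only [fourier_coe_apply, smul_eq_mul]
    congr 2
    have : (Real.pi : ℂ) ≠ 0 := by exact_mod_cast Real.pi_ne_zero
    push_cast
    field_simp
    ring

lemma gridCoeff_exp_neg_mul (f : ℝ → ℂ) (j : ℤ) :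
    gridCoeff (fun ξ => Complex.exp (-ξ * Complex.I) * f ξ) j = gridCoeff f (j + 1) := by
  rw [gridCoeff_eq, gridCoeff_eq]
  congr 1
  refine intervalIntegral.integral_congr fun ξ _ => ?_
  rw [← mul_assoc, ← Complex.exp_add]
  congr 2
  push_cast; ring

lemma gridCoeff_exp_mul (f : ℝ → ℂ) (j : ℤ) :
    gridCoeff (fun ξ => Complex.exp (ξ * Complex.I) * f ξ) j = gridCoeff f (j - 1) := by
  rw [gridCoeff_eq, gridCoeff_eq]
  congr 1
  refine intervalIntegral.integral_congr fun ξ _ => ?_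
  rw [← mul_assoc, ← Complex.exp_add]
  congr 2
  push_cast; ring

lemma gridCoeff_const_mul (c : ℂ) (f : ℝ → ℂ) (j : ℤ) :
    gridCoeff (fun ξ => c * f ξ) j = c * gridCoeff f j :=
  fourierCoeffOn.const_mul f c j _

lemma gridCoeff_add {f g : ℝ → ℂ} (hf : Continuous f) (hg : Continuous g) (j : ℤ) :
    gridCoeff (fun ξ => f ξ + g ξ) j = gridCoeff f j + gridCoeff g j := by
  simp only [gridCoeff_eq]
  rw [← smul_add, ← intervalIntegral.integral_add]
  · simp only [mul_add]
  · exact Continuous.intervalIntegrable (by fun_prop) _ _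
  · exact Continuous.intervalIntegrable (by fun_prop) _ _

lemma gridCoeff_sub {f g : ℝ → ℂ} (hf : Continuous f) (hg : Continuous g) (j : ℤ) :
    gridCoeff (fun ξ => f ξ - g ξ) j = gridCoeff f j - gridCoeff g j := by
  simp only [gridCoeff_eq]
  rw [← smul_sub, ← intervalIntegral.integral_sub]
  · simp only [mul_sub]
  · exact Continuous.intervalIntegrable (by fun_prop) _ _
  · exact Continuous.intervalIntegrable (by fun_prop) _ _

/-- Multiplication by a trigonometric polynomial of degree one is a three-point stencil. -/
lemma re_gridCoeff_stencil {f : ℝ → ℂ} (hf : Continuous f) (a b c : ℝ) (j : ℤ) :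
    (gridCoeff (fun ξ => ((a : ℂ) + b * Complex.exp (-ξ * Complex.I)
      + c * Complex.exp (ξ * Complex.I)) * f ξ) j).re =
    a * (gridCoeff f j).re + b * (gridCoeff f (j + 1)).re + c * (gridCoeff f (j - 1)).re := by
  have e : (fun ξ : ℝ => ((a : ℂ) + b * Complex.exp (-ξ * Complex.I)
      + c * Complex.exp (ξ * Complex.I)) * f ξ) = fun ξ => ((a : ℂ) * f ξ
      + b * (Complex.exp (-ξ * Complex.I) * f ξ)) + c * (Complex.exp (ξ * Complex.I) * f ξ) := by
    ext ξ; ring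
  rw [e, gridCoeff_add (by fun_prop) (by fun_prop), gridCoeff_add (by fun_prop) (by fun_prop),
    gridCoeff_const_mul, gridCoeff_const_mul, gridCoeff_const_mul, gridCoeff_exp_neg_mul,
    gridCoeff_exp_mul]
  simp

lemma gridCoeff_const (c : ℂ) (j : ℤ) : gridCoeff (fun _ => c) j = if j = 0 then c else 0 := by
  have hpi : (Real.pi : ℂ) ≠ 0 := by exact_mod_cast Real.pi_ne_zero
  rw [gridCoeff_eq, intervalIntegral.integral_mul_const]
  split_ifs with h
  · subst h
    simp
    field_simp
    norm_num
  · have hj : (-(j : ℂ) * Complex.I) ≠ 0 := by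
      simp [h]
    have e : ∀ ξ : ℝ, Complex.exp (-(j * ξ) * Complex.I)
        = Complex.exp ((-(j : ℂ) * Complex.I) * ξ) := fun ξ => by congr 1; ring
    simp_rw [e]
    rw [integral_exp_mul_complex hj]
    have e2 : Complex.exp ((-(j : ℂ) * Complex.I) * (Real.pi : ℝ))
        = Complex.exp ((-(j : ℂ) * Complex.I) * ((-Real.pi : ℝ) : ℂ)) := by
      rw [Complex.exp_eq_exp_iff_exists_int]
      exact ⟨-j, by push_cast; ring⟩
    rw [e2]
    simp

lemma memLp_two_of_continuous {f : ℝ → ℂ} (hf : Continuous f) :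
    MemLp f 2 (volume.restrict (Set.Ioc (-Real.pi) Real.pi)) := by
  obtain ⟨c, hc⟩ := isCompact_Icc.exists_bound_of_continuousOn
    (s := Set.Icc (-Real.pi) Real.pi) hf.continuousOn
  refine MemLp.of_bound hf.aestronglyMeasurable c ?_
  filter_upwards [ae_restrict_mem measurableSet_Ioc] with ξ hξ
  exact hc ξ (Set.Ioc_subset_Icc_self hξ)

/-- Parseval's identity for grid functions. -/
lemma hasSum_norm_gridCoeff_sq {f : ℝ → ℂ} (hf : Continuous f) :
    HasSum (fun j => ‖gridCoeff f j‖ ^ 2)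
      ((2 * Real.pi)⁻¹ * ∫ ξ in -Real.pi..Real.pi, ‖f ξ‖ ^ 2) := by
  have h := hasSum_sq_fourierCoeffOn (neg_lt_self Real.pi_pos) (memLp_two_of_continuous hf)
  rw [show Real.pi - -Real.pi = 2 * Real.pi by ring] at h
  exact h

lemma memℓp_re_gridCoeff {f : ℝ → ℂ} (hf : Continuous f) :
    Memℓp (fun j => (gridCoeff f j).re) 2 := by
  rw [memℓp_gen_iff (by norm_num)]
  refine Summable.of_nonneg_of_le (fun j => by positivity) (fun j => ?_)
    (hasSum_norm_gridCoeff_sq hf).summable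
  rw [ENNReal.toReal_ofNat, Real.rpow_two]
  exact pow_le_pow_left₀ (norm_nonneg _) (Complex.abs_re_le_norm _) 2

/-! ### Existence and uniqueness of the scheme -/

/-- One step of the scheme as an identity between two three-point stencils, in terms of `κ = √k`
and `R = κ / h`. -/
lemma isStep_iff_stencil (μ ρ θ σ z : ℝ) {κ h : ℝ} (hκ : 0 < κ) (hh : 0 < h) (hρ0 : 0 ≤ ρ)
    (w w' : ℤ → ℝ) :
    IsStep μ ρ θ σ (κ ^ 2) h z w w' ↔ ∀ j,
      (1 + (θ - σ * ρ) * (κ / h) ^ 2) * w' j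
        + (θ * μ * κ * (κ / h) / 2 - (θ - σ * ρ) * (κ / h) ^ 2 / 2) * w' (j + 1)
        + (-(θ * μ * κ * (κ / h) / 2) - (θ - σ * ρ) * (κ / h) ^ 2 / 2) * w' (j - 1)
      = (1 - (κ / h) ^ 2 * ((1 - θ) - (1 - σ) * ρ + ρ * z ^ 2)) * w j
        + ((κ / h) ^ 2 * ((1 - θ) - (1 - σ) * ρ + ρ * z ^ 2) / 2
            - (κ / h) * ((1 - θ) * μ * κ + Real.sqrt ρ * z) / 2) * w (j + 1)
        + ((κ / h) ^ 2 * ((1 - θ) - (1 - σ) * ρ + ρ * z ^ 2) / 2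
            + (κ / h) * ((1 - θ) * μ * κ + Real.sqrt ρ * z) / 2) * w (j - 1) := by
  unfold IsStep driftOp D1 D2
  rw [Real.sqrt_mul hρ0, Real.sqrt_sq hκ.le]
  refine forall_congr' fun j => ?_
  constructor
  · intro H
    rw [← sub_eq_zero] at H ⊢
    rw [← H]
    field_simp
    ring
  · intro H
    rw [← sub_eq_zero] at H ⊢
    rw [← H]
    field_simp
    ring

lemma symA_eq_stencil (μ ρ θ σ R κ ξ : ℝ) : symA μ ρ θ σ R κ ξ =
    ((1 + (θ - σ * ρ) * R ^ 2 : ℝ) : ℂ)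
      + ((θ * μ * κ * R / 2 - (θ - σ * ρ) * R ^ 2 / 2 : ℝ) : ℂ) * Complex.exp (-ξ * Complex.I)
      + ((-(θ * μ * κ * R / 2) - (θ - σ * ρ) * R ^ 2 / 2 : ℝ) : ℂ)
        * Complex.exp (ξ * Complex.I) := by
  rw [neg_mul, ← neg_mul, Complex.exp_mul_I, Complex.exp_mul_I, Complex.cos_neg, Complex.sin_neg]
  unfold symA symS symY
  push_cast
  ring

lemma symB_eq_stencil (μ ρ θ σ R κ ξ z : ℝ) : symB μ ρ θ σ R κ ξ z =
    ((1 - R ^ 2 * ((1 - θ) - (1 - σ) * ρ + ρ * z ^ 2) : ℝ) : ℂ)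
      + ((R ^ 2 * ((1 - θ) - (1 - σ) * ρ + ρ * z ^ 2) / 2
            - R * ((1 - θ) * μ * κ + Real.sqrt ρ * z) / 2 : ℝ) : ℂ) * Complex.exp (-ξ * Complex.I)
      + ((R ^ 2 * ((1 - θ) - (1 - σ) * ρ + ρ * z ^ 2) / 2
            + R * ((1 - θ) * μ * κ + Real.sqrt ρ * z) / 2 : ℝ) : ℂ)
        * Complex.exp (ξ * Complex.I) := by
  rw [neg_mul, ← neg_mul, Complex.exp_mul_I, Complex.exp_mul_I, Complex.cos_neg, Complex.sin_neg]
  unfold symB symS symY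
  push_cast
  ring

lemma isStep_re_gridCoeff (μ ρ θ σ z : ℝ) {κ h : ℝ} (hκ : 0 < κ) (hh : 0 < h) (hρ0 : 0 ≤ ρ)
    {f f' : ℝ → ℂ} (hf : Continuous f) (hf' : Continuous f')
    (H : ∀ ξ, symA μ ρ θ σ (κ / h) κ ξ * f' ξ = symB μ ρ θ σ (κ / h) κ ξ z * f ξ) :
    IsStep μ ρ θ σ (κ ^ 2) h z (fun j => (gridCoeff f j).re) (fun j => (gridCoeff f' j).re) := by
  rw [isStep_iff_stencil μ ρ θ σ z hκ hh hρ0]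
  intro j
  rw [← re_gridCoeff_stencil hf', ← re_gridCoeff_stencil hf]
  congr 2
  ext ξ
  rw [← symA_eq_stencil, ← symB_eq_stencil, H]

/-- Energy argument: in `ℓ²(ℤ)` the skew-symmetric part of the stencil does not contribute, and the
symmetric part is coercive as soon as its symbol is positive at the highest frequency. -/
lemma eq_zero_of_stencil_eq_zero {d : ℤ → ℝ} (hd : Memℓp d 2) {α β : ℝ} (hβ : 0 < 1 + 4 * β)
    (H : ∀ j, (1 + 2 * β) * d j + (α - β) * d (j + 1) + (-α - β) * d (j - 1) = 0) : d = 0 := by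
  have hsq : Summable fun j => d j ^ 2 := by
    rw [memℓp_gen_iff (by norm_num)] at hd
    simpa using hd
  have hsq1 : Summable fun j : ℤ => d (j + 1) ^ 2 :=
    (Equiv.addRight (1 : ℤ)).summable_iff.2 hsq
  have hp : Summable fun j => d j * d (j + 1) := by
    refine Summable.of_norm_bounded (hsq.add hsq1) fun j => ?_
    rw [Real.norm_eq_abs, abs_le]
    constructor <;> nlinarith [sq_nonneg (d j + d (j + 1)), sq_nonneg (d j - d (j + 1))]
  have hp1 : Summable fun j : ℤ => d j * d (j - 1) := by
    have := (Equiv.subRight (1 : ℤ)).summable_iff.2 hp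
    refine this.congr fun j => ?_
    simp [mul_comm]
  set Q := ∑' j, d j ^ 2 with hQ
  set S := ∑' j, d j * d (j + 1) with hS
  have hQ0 : 0 ≤ Q := tsum_nonneg fun j => sq_nonneg _
  have hQ1 : ∑' j : ℤ, d (j + 1) ^ 2 = Q := (Equiv.addRight (1 : ℤ)).tsum_eq fun j => d j ^ 2
  have hS1 : ∑' j : ℤ, d j * d (j - 1) = S := by
    rw [hS, ← (Equiv.subRight (1 : ℤ)).tsum_eq fun j => d j * d (j + 1)]
    refine tsum_congr fun j => ?_
    simp [mul_comm]
  have hsum : (1 + 2 * β) * Q + (α - β) * S + (-α - β) * S = 0 := by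
    calc (1 + 2 * β) * Q + (α - β) * S + (-α - β) * S
        = ∑' j, ((1 + 2 * β) * d j ^ 2 + (α - β) * (d j * d (j + 1))
            + (-α - β) * (d j * d (j - 1))) := by
          rw [((hsq.mul_left _).add (hp.mul_left _)).tsum_add (hp1.mul_left _),
            (hsq.mul_left _).tsum_add (hp.mul_left _), tsum_mul_left, tsum_mul_left, tsum_mul_left,
            hS1]
      _ = ∑' _ : ℤ, (0 : ℝ) := by
          refine tsum_congr fun j => ?_
          linear_combination d j * H j
      _ = 0 := tsum_zero
  have hSQ : S ≤ Q := by
    have : 2 * S ≤ Q + Q := by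
      calc 2 * S = ∑' j, 2 * (d j * d (j + 1)) := tsum_mul_left.symm
        _ ≤ ∑' j, (d j ^ 2 + d (j + 1) ^ 2) := by
            refine (hp.mul_left 2).tsum_le_tsum (fun j => ?_) (hsq.add hsq1)
            nlinarith [sq_nonneg (d j - d (j + 1))]
        _ = Q + Q := by rw [hsq.tsum_add hsq1, hQ1]
    linarith
  have hSQ' : -Q ≤ S := by
    have : -(Q + Q) ≤ 2 * S := by
      calc -(Q + Q) = ∑' j, -(d j ^ 2 + d (j + 1) ^ 2) := by
            rw [tsum_neg, hsq.tsum_add hsq1, hQ1]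
        _ ≤ ∑' j, 2 * (d j * d (j + 1)) := by
            refine (hsq.add hsq1).neg.tsum_le_tsum (fun j => ?_) (hp.mul_left 2)
            nlinarith [sq_nonneg (d j + d (j + 1))]
        _ = 2 * S := tsum_mul_left
    linarith
  have hQz : Q = 0 := by
    rcases le_total 0 β with h | h
    · nlinarith
    · nlinarith
  ext j
  have h1 : d j ^ 2 ≤ Q := hsq.le_tsum j fun i _ => sq_nonneg _
  have h2 : d j ^ 2 = 0 := le_antisymm (h1.trans hQz.le) (sq_nonneg _)
  simpa using h2

lemma isStep_unique {μ ρ θ σ z κ h : ℝ} (hκ : 0 < κ) (hh : 0 < h) (hρ0 : 0 ≤ ρ)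
    (hstab : (κ / h) ^ 2 * stabFun ρ θ σ < 1) {w w₁ w₂ : ℤ → ℝ}
    (h₁ : IsStep μ ρ θ σ (κ ^ 2) h z w w₁) (h₂ : IsStep μ ρ θ σ (κ ^ 2) h z w w₂)
    (hw₁ : Memℓp w₁ 2) (hw₂ : Memℓp w₂ 2) : w₁ = w₂ := by
  rw [isStep_iff_stencil μ ρ θ σ z hκ hh hρ0] at h₁ h₂
  refine sub_eq_zero.1 (eq_zero_of_stencil_eq_zero (hw₁.sub hw₂)
    (α := θ * μ * κ * (κ / h) / 2) (β := (θ - σ * ρ) * (κ / h) ^ 2 / 2) ?_ fun j => ?_)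
  · unfold stabFun at hstab
    nlinarith [mul_nonneg (sq_nonneg (κ / h)) (sq_nonneg ρ), sq_nonneg (κ / h)]
  · simp only [Pi.sub_apply]
    linear_combination h₁ j - h₂ j

/-- Amplification factor of the frequency `ξ` over the first `n` steps of the scheme. -/
def modeProd (μ ρ θ σ R κ : ℝ) (n : ℕ) (z : ℕ → ℝ) (ξ : ℝ) : ℂ :=
  ∏ m ∈ Finset.range n, symC μ ρ θ σ R κ ξ (z m)

/-- The solution of the scheme with standardised increments `z`, through its Fourier transform. -/
def schemeSol (μ ρ θ σ κ h : ℝ) (n : ℕ) (z : ℕ → ℝ) (j : ℤ) : ℝ :=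
  (gridCoeff (fun ξ => (h⁻¹ : ℂ) * modeProd μ ρ θ σ (κ / h) κ n z ξ) j).re

lemma continuous_uncurry_modeProd {μ ρ θ σ R κ : ℝ} (hA : ∀ ξ, symA μ ρ θ σ R κ ξ ≠ 0) (n : ℕ) :
    Continuous fun p : (ℕ → ℝ) × ℝ => modeProd μ ρ θ σ R κ n p.1 p.2 := by
  unfold modeProd symC
  refine continuous_finsetProd _ fun m _ => Continuous.div₀ ?_ ?_ fun p => hA _
  · unfold symB symS symY; fun_prop
  · unfold symA symS symY; fun_prop

lemma continuous_modeProd {μ ρ θ σ R κ : ℝ} (hA : ∀ ξ, symA μ ρ θ σ R κ ξ ≠ 0) (n : ℕ)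
    (z : ℕ → ℝ) : Continuous (modeProd μ ρ θ σ R κ n z) := by
  have hz : Continuous fun ξ : ℝ => (z, ξ) := Continuous.prodMk_right z
  have h := (continuous_uncurry_modeProd hA n).comp hz
  exact h

lemma measurable_schemeSol {μ ρ θ σ κ h : ℝ} (hA : ∀ ξ, symA μ ρ θ σ (κ / h) κ ξ ≠ 0) (n : ℕ)
    (j : ℤ) : Measurable fun z => schemeSol μ ρ θ σ κ h n z j := by
  unfold schemeSol
  simp only [gridCoeff_eq, intervalIntegral.integral_of_le (neg_le_self Real.pi_pos.le)]
  have hc : Continuous fun p : (ℕ → ℝ) × ℝ => Complex.exp (-(j * p.2) * Complex.I) *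
      ((h⁻¹ : ℂ) * modeProd μ ρ θ σ (κ / h) κ n p.1 p.2) := by
    have := continuous_uncurry_modeProd hA n
    fun_prop
  have hm := hc.stronglyMeasurable.integral_prod_right'
    (ν := volume.restrict (Set.Ioc (-Real.pi) Real.pi))
  exact Complex.measurable_re.comp
    ((measurable_const_smul (1 / (2 * Real.pi) : ℝ)).comp hm.measurable)

lemma schemeSol_zero (μ ρ θ σ κ h : ℝ) (z : ℕ → ℝ) :
    schemeSol μ ρ θ σ κ h 0 z = diracGrid h := by
  ext j
  simp only [schemeSol, modeProd, Finset.range_zero, Finset.prod_empty, mul_one, diracGrid]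
  rw [gridCoeff_const]
  split_ifs
  · rw [← Complex.ofReal_inv, Complex.ofReal_re, one_div]
  · simp

variable {Ω : Type*} [MeasurableSpace Ω]

lemma aemeasurable_increment {P : Measure Ω} {M : ℝ≥0 → Ω → ℝ} (hM : IsPreBrownianReal M P)
    (k : ℝ≥0) (n : ℕ) : AEMeasurable (increment M k n) P :=
  ((hM.aemeasurable _).sub (hM.aemeasurable _)).div_const _

lemma isMilsteinScheme_schemeSol {P : Measure Ω} {M : ℝ≥0 → Ω → ℝ} (hM : IsPreBrownianReal M P)
    (μ : ℝ) {ρ θ σ h : ℝ} {k : ℝ≥0} (hk : 0 < k) (hh : 0 < h) (hρ0 : 0 ≤ ρ)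
    (hstab : (Real.sqrt k / h) ^ 2 * stabFun ρ θ σ < 1) :
    IsMilsteinScheme P M μ ρ θ σ k h
      fun n ω => schemeSol μ ρ θ σ (Real.sqrt k) h n fun m => increment M k m ω := by
  have hκ : 0 < Real.sqrt k := Real.sqrt_pos.2 hk
  obtain ⟨c₀, hc₀, hA'⟩ := exists_le_re_symA (div_pos hκ hh) hstab
  have hA : ∀ ξ, symA μ ρ θ σ (Real.sqrt k / h) (Real.sqrt k) ξ ≠ 0 := fun ξ =>
    norm_pos_iff.1 (hc₀.trans_le (le_norm_symA_of_le_re (hA' _ _ _)))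
  have hcont : ∀ n z, Continuous fun ξ =>
      (h⁻¹ : ℂ) * modeProd μ ρ θ σ (Real.sqrt k / h) (Real.sqrt k) n z ξ :=
    fun n z => continuous_const.mul (continuous_modeProd hA n z)
  refine ⟨fun n j => ?_, fun n ω => memℓp_re_gridCoeff (hcont _ _),
    fun ω => schemeSol_zero _ _ _ _ _ _ _, fun n ω => ?_⟩
  · exact (measurable_schemeSol hA n j).comp_aemeasurable
      (aemeasurable_pi_lambda _ fun m => aemeasurable_increment hM k m)
  · have hk2 : (k : ℝ) = Real.sqrt k ^ 2 := (Real.sq_sqrt k.2).symm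
    have := isStep_re_gridCoeff μ ρ θ σ (increment M k n ω) hκ hh hρ0
      (hcont n fun m => increment M k m ω) (hcont (n + 1) fun m => increment M k m ω) fun ξ => by
        rw [modeProd, Finset.prod_range_succ, ← modeProd, symC]
        have := hA ξ
        field_simp
    rwa [← hk2] at this

lemma IsMilsteinScheme.eq {P : Measure Ω} {M : ℝ≥0 → Ω → ℝ} {μ ρ θ σ h : ℝ} {k : ℝ≥0}
    (hk : 0 < k) (hh : 0 < h) (hρ0 : 0 ≤ ρ)
    (hstab : (Real.sqrt k / h) ^ 2 * stabFun ρ θ σ < 1) {V W : ℕ → Ω → ℤ → ℝ}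
    (hV : IsMilsteinScheme P M μ ρ θ σ k h V) (hW : IsMilsteinScheme P M μ ρ θ σ k h W) :
    V = W := by
  have hκ : 0 < Real.sqrt k := Real.sqrt_pos.2 hk
  have hk2 : (k : ℝ) = Real.sqrt k ^ 2 := (Real.sq_sqrt k.2).symm
  ext n ω : 2
  induction n with
  | zero => rw [hV.initial, hW.initial]
  | succ n ih =>
    have h1 := hV.step n ω
    have h2 := hW.step n ω
    rw [← ih] at h2
    rw [hk2] at h1 h2
    exact isStep_unique hκ hh hρ0 hstab h1 h2 (hV.memℓp _ _) (hW.memℓp _ _)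

/-! ### The exact solution on the grid -/

/-- Fourier transform, at the wave number `ξ / h`, of the Gaussian density with variance `τ` and
mean `s` (with the sign convention `∫ v(x) e^{ixη} dx`). -/
def exactMode (τ s h ξ : ℝ) : ℂ :=
  Complex.exp (((-(τ / 2) * (ξ / h) ^ 2 : ℝ) : ℂ) + ((s * (ξ / h) : ℝ) : ℂ) * Complex.I)

lemma norm_exactMode (τ s h ξ : ℝ) : ‖exactMode τ s h ξ‖ = Real.exp (-(τ / 2) * (ξ / h) ^ 2) := by
  rw [exactMode, Complex.norm_exp]
  congr 1
  simp [-Complex.ofReal_mul, -Complex.ofReal_add, -Complex.ofReal_pow, -Complex.ofReal_div]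

/-- Fourier transform of the exact solution restricted to the grid: the sum of `exactMode` over all
frequencies that the grid cannot tell apart. -/
def aliasedMode (τ s h ξ : ℝ) : ℂ := ∑' m : ℤ, exactMode τ s h (ξ + 2 * Real.pi * m)

/-- The density of the Gaussian law with mean `s` and variance `τ`, at the point `x`. -/
def gaussDensity (τ s x : ℝ) : ℝ :=
  (Real.sqrt (2 * Real.pi * τ))⁻¹ * Real.exp (-(x - s) ^ 2 / (2 * τ))

lemma summable_gaussDensity {τ h : ℝ} (hτ : 0 < τ) (hh : 0 < h) (s : ℝ) :
    Summable fun j : ℤ => gaussDensity τ s (j * h) := by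
  refine Summable.mul_left _ ?_
  have h0 := (summable_pow_mul_jacobiTheta₂_term_bound (|h * s / τ| / (2 * Real.pi))
    (T := h ^ 2 / (2 * τ * Real.pi)) (by positivity) 0)
  refine Summable.of_nonneg_of_le (fun j => (Real.exp_pos _).le) (fun j => ?_) h0
  rw [pow_zero, one_mul]
  refine Real.exp_le_exp.2 ?_
  have h1 : -Real.pi * (h ^ 2 / (2 * τ * Real.pi) * (j : ℝ) ^ 2
      - 2 * (|h * s / τ| / (2 * Real.pi)) * |(j : ℝ)|)
      = -(h ^ 2 * j ^ 2) / (2 * τ) + |h * s / τ * j| := by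
    rw [abs_mul]; field_simp; ring
  have h2 : -((j : ℝ) * h - s) ^ 2 / (2 * τ)
      = -(h ^ 2 * j ^ 2) / (2 * τ) + h * s / τ * j - s ^ 2 / (2 * τ) := by
    field_simp; ring
  push_cast
  rw [h1, h2]
  have := le_abs_self (h * s / τ * j)
  have : 0 ≤ s ^ 2 / (2 * τ) := by positivity
  linarith

/-- Poisson summation for the Gaussian density on the grid. -/
lemma tsum_gaussDensity_mul_exp {τ h : ℝ} (hτ : 0 < τ) (hh : 0 < h) (s ξ : ℝ) :
    ∑' j : ℤ, (gaussDensity τ s (j * h) : ℂ) * Complex.exp (j * ξ * Complex.I) =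
      (h⁻¹ : ℂ) * aliasedMode τ s h ξ := by
  have hpi : (Real.pi : ℂ) ≠ 0 := by exact_mod_cast Real.pi_ne_zero
  have hτc : (τ : ℂ) ≠ 0 := by exact_mod_cast hτ.ne'
  have hhc : (h : ℂ) ≠ 0 := by exact_mod_cast hh.ne'
  set a : ℝ := h ^ 2 / (2 * Real.pi * τ) with ha
  have ha0 : 0 < a := by positivity
  set b : ℂ := ((h * s / τ : ℝ) + ξ * Complex.I) / (2 * Real.pi) with hb
  have key := Complex.tsum_exp_neg_quadratic (a := a) (by simpa using ha0) b
  have hL : ∀ j : ℤ, (gaussDensity τ s (j * h) : ℂ) * Complex.exp (j * ξ * Complex.I) =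
      (((Real.sqrt (2 * Real.pi * τ))⁻¹ * Real.exp (-s ^ 2 / (2 * τ)) : ℝ) : ℂ) *
        Complex.exp (-Real.pi * a * j ^ 2 + 2 * Real.pi * b * j) := by
    intro j
    rw [gaussDensity, mul_assoc 2]
    simp only [Complex.ofReal_mul, Complex.ofReal_exp]
    rw [mul_assoc (((Real.sqrt (2 * (Real.pi * τ)))⁻¹ : ℝ) : ℂ),
      mul_assoc (((Real.sqrt (2 * (Real.pi * τ)))⁻¹ : ℝ) : ℂ), ← Complex.exp_add, ← Complex.exp_add]
    congr 2
    simp only [ha, hb]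
    push_cast
    field_simp
    ring
  have hR : ∀ n : ℤ, Complex.exp (-Real.pi / a * (n + Complex.I * b) ^ 2) =
      (Real.exp (s ^ 2 / (2 * τ)) : ℂ) * exactMode τ s h (ξ + 2 * Real.pi * ((-n : ℤ) : ℝ)) := by
    intro n
    rw [exactMode, Complex.ofReal_exp, ← Complex.exp_add]
    congr 1
    simp only [ha, hb]
    have hI : Complex.I * (((h * s / τ : ℝ) + ξ * Complex.I) / (2 * Real.pi)) =
        ((h * s / τ : ℝ) * Complex.I - ξ) / (2 * Real.pi) := by
      linear_combination (ξ / (2 * Real.pi) : ℂ) * Complex.I_sq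
    rw [hI]
    push_cast
    field_simp
    ring_nf
    rw [Complex.I_sq]
    ring
  simp_rw [hL, tsum_mul_left, key, hR, tsum_mul_left]
  have hneg : ∑' n : ℤ, exactMode τ s h (ξ + 2 * Real.pi * ((-n : ℤ) : ℝ)) = aliasedMode τ s h ξ :=
    (Equiv.neg ℤ).tsum_eq fun m : ℤ => exactMode τ s h (ξ + 2 * Real.pi * m)
  rw [hneg]
  have hsqrt : (a : ℂ) ^ (1 / 2 : ℂ) = ((h / Real.sqrt (2 * Real.pi * τ) : ℝ) : ℂ) := by
    rw [show (1 / 2 : ℂ) = ((1 / 2 : ℝ) : ℂ) by push_cast; rfl, ← Complex.ofReal_cpow ha0.le,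
      ← Real.sqrt_eq_rpow, ha, Real.sqrt_div' _ (by positivity), Real.sqrt_sq hh.le]
  have hs0 : 0 < Real.sqrt (2 * Real.pi * τ) := by positivity
  have hs0c : ((Real.sqrt (2 * Real.pi * τ) : ℝ) : ℂ) ≠ 0 := by exact_mod_cast hs0.ne'
  have hee : (Real.exp (-s ^ 2 / (2 * τ)) : ℂ) * (Real.exp (s ^ 2 / (2 * τ)) : ℂ) = 1 := by
    rw [← Complex.ofReal_mul, ← Real.exp_add]
    rw [show -s ^ 2 / (2 * τ) + s ^ 2 / (2 * τ) = 0 by ring]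
    simp
  rw [hsqrt, Complex.ofReal_mul, Complex.ofReal_div, Complex.ofReal_inv]
  generalize aliasedMode τ s h ξ = X
  generalize (Real.exp (-s ^ 2 / (2 * τ)) : ℂ) = e₁ at *
  generalize (Real.exp (s ^ 2 / (2 * τ)) : ℂ) = e₂ at *
  generalize ((Real.sqrt (2 * Real.pi * τ) : ℝ) : ℂ) = q at *
  field_simp
  linear_combination X * hee

lemma norm_gaussDensity_mul_exp {τ : ℝ} (s x ξ : ℝ) (j : ℤ) :
    ‖(gaussDensity τ s x : ℂ) * Complex.exp (j * ξ * Complex.I)‖ = gaussDensity τ s x := by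
  have h0 : 0 ≤ gaussDensity τ s x := by unfold gaussDensity; positivity
  rw [norm_mul, Complex.norm_real, Real.norm_of_nonneg h0]
  have : ‖Complex.exp ((j : ℂ) * ξ * Complex.I)‖ = 1 := by
    have := Complex.norm_exp_ofReal_mul_I (j * ξ)
    simpa using this
  rw [this, mul_one]

lemma continuous_aliasedMode {τ h : ℝ} (hτ : 0 < τ) (hh : 0 < h) (s : ℝ) :
    Continuous (aliasedMode τ s h) := by
  have hhc : (h : ℂ) ≠ 0 := by exact_mod_cast hh.ne'
  have e : aliasedMode τ s h = fun ξ : ℝ =>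
      (h : ℂ) * ∑' j : ℤ, (gaussDensity τ s (j * h) : ℂ) * Complex.exp (j * ξ * Complex.I) := by
    ext ξ
    rw [tsum_gaussDensity_mul_exp hτ hh]
    field_simp
  rw [e]
  refine continuous_const.mul (continuous_tsum (fun j => by fun_prop)
    (summable_gaussDensity hτ hh s) fun j ξ => ?_)
  exact (norm_gaussDensity_mul_exp s _ ξ j).le

lemma gridCoeff_aliasedMode {τ h : ℝ} (hτ : 0 < τ) (hh : 0 < h) (s : ℝ) (j : ℤ) :
    gridCoeff (fun ξ => (h⁻¹ : ℂ) * aliasedMode τ s h ξ) j = gaussDensity τ s (j * h) := by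
  simp_rw [← tsum_gaussDensity_mul_exp hτ hh]
  have hterm : ∀ i : ℤ, gridCoeff (fun ξ => (gaussDensity τ s (i * h) : ℂ)
      * Complex.exp (i * ξ * Complex.I)) j
      = if i = j then (gaussDensity τ s (j * h) : ℂ) else 0 := by
    intro i
    have h1 : gridCoeff (fun ξ => (gaussDensity τ s (i * h) : ℂ)
        * Complex.exp (i * ξ * Complex.I)) j
        = gridCoeff (fun _ => (gaussDensity τ s (i * h) : ℂ)) (j - i) := by
      rw [gridCoeff_eq, gridCoeff_eq]
      congr 1
      refine intervalIntegral.integral_congr fun ξ _ => ?_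
      rw [mul_left_comm, ← Complex.exp_add, mul_comm]
      congr 2
      push_cast; ring
    rw [h1, gridCoeff_const]
    by_cases hij : i = j
    · simp [hij]
    · have : j - i ≠ 0 := sub_ne_zero.2 (Ne.symm hij)
      simp [hij, this]
  have hsum := intervalIntegral.hasSum_intervalIntegral_of_summable_norm
    (a := -Real.pi) (b := Real.pi)
    (f := fun i : ℤ => (⟨fun ξ : ℝ => Complex.exp (-(j * ξ) * Complex.I)
      * ((gaussDensity τ s (i * h) : ℂ) * Complex.exp (i * ξ * Complex.I)), by fun_prop⟩ :
        C(ℝ, ℂ))) (by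
    refine Summable.of_nonneg_of_le (fun i => norm_nonneg _) (fun i => ?_)
      (summable_gaussDensity hτ hh s)
    have h0 : 0 ≤ gaussDensity τ s (i * h) := by unfold gaussDensity; positivity
    refine (ContinuousMap.norm_le _ h0).2 fun ξ => ?_
    simp only [ContinuousMap.restrict_apply, ContinuousMap.coe_mk]
    rw [norm_mul, norm_gaussDensity_mul_exp]
    have : ‖Complex.exp (-((j : ℂ) * ((ξ : ℝ) : ℂ)) * Complex.I)‖ = 1 := by
      have := Complex.norm_exp_ofReal_mul_I (-(j * (ξ : ℝ)))
      simpa using this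
    rw [this, one_mul])
  simp only [ContinuousMap.coe_mk] at hsum
  have hsum2 := hsum.const_smul (1 / (2 * Real.pi) : ℝ)
  simp_rw [← gridCoeff_eq] at hsum2
  simp_rw [hterm] at hsum2
  have h3 := hsum2.unique (hasSum_ite_eq j (gaussDensity τ s (j * h) : ℂ))
  rw [gridCoeff_eq, ← h3]
  congr 1
  refine intervalIntegral.integral_congr fun ξ _ => ?_
  rw [tsum_mul_left]

/-- The aliasing error is of second order in `h`, with a Gaussian weight in the wave number. -/
lemma norm_aliasedMode_sub_le {τ : ℝ} (hτ : 0 < τ) :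
    ∃ K ≥ 0, ∀ s h ξ : ℝ, 0 < h → |ξ| ≤ Real.pi →
      ‖aliasedMode τ s h ξ - exactMode τ s h ξ‖ ≤
        K * h ^ 2 * Real.exp (-(τ / 4) * (ξ / h) ^ 2) := by
  have hs2 : Summable fun m : ℤ => 1 / (m : ℝ) ^ 2 := Real.summable_one_div_int_pow.2 (by norm_num)
  refine ⟨4 / (τ * Real.pi ^ 2) * ∑' m : ℤ, 1 / (m : ℝ) ^ 2,
    mul_nonneg (by positivity) (tsum_nonneg fun m => by positivity), fun s h ξ hh hξ => ?_⟩
  set E := Real.exp (-(τ / 4) * (ξ / h) ^ 2) with hE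
  set f : ℤ → ℂ := fun m => exactMode τ s h (ξ + 2 * Real.pi * m) with hf
  set bnd : ℤ → ℝ := fun m => (4 / (τ * Real.pi ^ 2) * h ^ 2 * E) * (1 / (m : ℝ) ^ 2) with hbnd
  have hbs : Summable bnd := hs2.mul_left _
  have hle : ∀ m, ‖f m - if m = 0 then f 0 else 0‖ ≤ bnd m := by
    intro m
    by_cases hm : m = 0
    · simp [hm, hbnd]
    · rw [if_neg hm, sub_zero, hf]
      simp only
      rw [norm_exactMode]
      have hm1 : (1 : ℝ) ≤ |(m : ℝ)| := by
        have := Int.one_le_abs hm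
        exact_mod_cast this
      -- `|ξ + 2πm| ≥ π |m|` and `|ξ + 2πm| ≥ |ξ|` for frequencies `|ξ| ≤ π`
      have hlow : Real.pi * |(m : ℝ)| ≤ |ξ + 2 * Real.pi * m| := by
        have h1 := abs_sub_abs_le_abs_sub (2 * Real.pi * (m : ℝ)) (-ξ)
        rw [abs_neg, abs_mul, abs_of_pos Real.two_pi_pos, sub_neg_eq_add, add_comm _ ξ] at h1
        nlinarith [Real.pi_pos]
      have hlow2 : |ξ| ≤ |ξ + 2 * Real.pi * m| := by nlinarith [Real.pi_pos]
      have hsq1 : Real.pi ^ 2 * (m : ℝ) ^ 2 ≤ (ξ + 2 * Real.pi * m) ^ 2 := by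
        have := pow_le_pow_left₀ (by positivity) hlow 2
        rwa [mul_pow, sq_abs, sq_abs] at this
      have hsq2 : ξ ^ 2 ≤ (ξ + 2 * Real.pi * m) ^ 2 := sq_le_sq.2 hlow2
      have hm0 : (0 : ℝ) < (m : ℝ) ^ 2 := by
        have : (m : ℝ) ≠ 0 := by exact_mod_cast hm
        positivity
      set x := τ / 4 * (Real.pi ^ 2 * (m : ℝ) ^ 2) / h ^ 2 with hx
      have hx0 : 0 < x := by positivity
      have hexp : -(τ / 2) * ((ξ + 2 * Real.pi * m) / h) ^ 2 ≤ -(τ / 4) * (ξ / h) ^ 2 + -x := by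
        rw [hx, div_pow, div_pow]
        have : -(τ / 4) * (ξ ^ 2 / h ^ 2) + -(τ / 4 * (Real.pi ^ 2 * (m : ℝ) ^ 2) / h ^ 2)
          - (-(τ / 2) * ((ξ + 2 * Real.pi * m) ^ 2 / h ^ 2))
          = τ / 4 * (((ξ + 2 * Real.pi * m) ^ 2 - ξ ^ 2)
            + ((ξ + 2 * Real.pi * m) ^ 2 - Real.pi ^ 2 * (m : ℝ) ^ 2)) / h ^ 2 := by
          field_simp; ring
        have h2 : 0 ≤ τ / 4 * (((ξ + 2 * Real.pi * m) ^ 2 - ξ ^ 2)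
            + ((ξ + 2 * Real.pi * m) ^ 2 - Real.pi ^ 2 * (m : ℝ) ^ 2)) / h ^ 2 := by
          have : 0 ≤ ((ξ + 2 * Real.pi * m) ^ 2 - ξ ^ 2)
            + ((ξ + 2 * Real.pi * m) ^ 2 - Real.pi ^ 2 * (m : ℝ) ^ 2) := by linarith
          positivity
        linarith
      have hxinv : Real.exp (-x) ≤ 1 / x := by
        rw [Real.exp_neg, one_div]
        refine inv_anti₀ hx0 ?_
        linarith [Real.add_one_le_exp x]
      calc Real.exp (-(τ / 2) * ((ξ + 2 * Real.pi * m) / h) ^ 2)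
          ≤ E * Real.exp (-x) := by rw [hE, ← Real.exp_add]; exact Real.exp_le_exp.2 hexp
        _ ≤ E * (1 / x) := by gcongr
        _ = bnd m := by simp only [hx, hbnd]; field_simp
  have hsub : Summable fun m => f m - if m = 0 then f 0 else 0 := Summable.of_norm_bounded hbs hle
  have hsingle := hasSum_ite_eq (0 : ℤ) (f 0)
  have hfs : Summable f := by
    have := hsub.add hsingle.summable
    simpa using this
  have h0 : f 0 = exactMode τ s h ξ := by simp [hf]
  have htot : aliasedMode τ s h ξ - exactMode τ s h ξ
      = ∑' m, (f m - if m = 0 then f 0 else 0) := by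
    rw [hfs.tsum_sub hsingle.summable, hsingle.tsum_eq, h0]
    rfl
  rw [htot]
  refine (tsum_of_norm_bounded hbs.hasSum hle).trans_eq ?_
  rw [hbnd, tsum_mul_left]
  ring

/-! ### Spatial norms in Fourier space -/

lemma gridNorm_two_sq_le {f : ℝ → ℂ} (hf : Continuous f) {h : ℝ} (hh : 0 < h) :
    gridNorm h 2 (fun j => (gridCoeff f j).re) ^ 2 ≤
      ∫⁻ ξ in Set.Ioc (-Real.pi) Real.pi, ENNReal.ofReal (h * ‖f ξ‖ ^ 2) := by
  have hs := hasSum_norm_gridCoeff_sq hf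
  have h1 : gridNorm h 2 (fun j => (gridCoeff f j).re) ^ 2 =
      ENNReal.ofReal h * ∑' j : ℤ, ENNReal.ofReal ((gridCoeff f j).re ^ 2) := by
    rw [gridNorm, eLpNorm_eq_lintegral_rpow_enorm_toReal (by norm_num) (by norm_num),
      lintegral_smul_measure, lintegral_count, ← ENNReal.rpow_two, ← ENNReal.rpow_mul]
    norm_num
    congr 1
    refine tsum_congr fun j => ?_
    rw [Real.enorm_eq_ofReal_abs, ← ENNReal.ofReal_pow (abs_nonneg _), sq_abs]
  have hint : IntegrableOn (fun ξ => h * ‖f ξ‖ ^ 2) (Set.Ioc (-Real.pi) Real.pi) :=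
    (Continuous.integrableOn_Icc (by fun_prop)).mono_set Set.Ioc_subset_Icc_self
  rw [h1, ← ofReal_integral_eq_lintegral_ofReal hint (ae_of_all _ fun ξ => by positivity)]
  calc ENNReal.ofReal h * ∑' j : ℤ, ENNReal.ofReal ((gridCoeff f j).re ^ 2)
      ≤ ENNReal.ofReal h * ∑' j : ℤ, ENNReal.ofReal (‖gridCoeff f j‖ ^ 2) := by
        refine mul_le_mul_right (ENNReal.tsum_le_tsum fun j => ?_) _
        refine ENNReal.ofReal_le_ofReal ?_
        rw [← sq_abs]
        exact pow_le_pow_left₀ (abs_nonneg _) (Complex.abs_re_le_norm _) 2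
    _ = ENNReal.ofReal (h * ((2 * Real.pi)⁻¹ * ∫ ξ in -Real.pi..Real.pi, ‖f ξ‖ ^ 2)) := by
        rw [← ENNReal.ofReal_tsum_of_nonneg (fun j => by positivity) hs.summable, hs.tsum_eq,
          ENNReal.ofReal_mul hh.le]
    _ ≤ _ := by
        refine ENNReal.ofReal_le_ofReal ?_
        rw [intervalIntegral.integral_of_le (neg_le_self Real.pi_pos.le), integral_const_mul]
        have h0 : 0 ≤ ∫ ξ in Set.Ioc (-Real.pi) Real.pi, ‖f ξ‖ ^ 2 :=
          integral_nonneg fun ξ => by positivity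
        refine mul_le_mul_of_nonneg_left ?_ hh.le
        refine mul_le_of_le_one_left h0 (inv_le_one_of_one_le₀ ?_)
        linarith [Real.pi_gt_three]

lemma gridNorm_top_le {f : ℝ → ℂ} (h : ℝ) :
    gridNorm h ∞ (fun j => (gridCoeff f j).re) ≤
      ENNReal.ofReal (2 * Real.pi)⁻¹ * ∫⁻ ξ in Set.Ioc (-Real.pi) Real.pi, ‖f ξ‖ₑ := by
  rw [gridNorm, eLpNorm_exponent_top]
  refine eLpNormEssSup_le_of_ae_enorm_bound (ae_of_all _ fun j => ?_)
  have h1 : ‖(gridCoeff f j).re‖ₑ ≤ ‖gridCoeff f j‖ₑ :=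
    enorm_le_iff_norm_le.2 (Complex.abs_re_le_norm _)
  refine h1.trans ?_
  rw [gridCoeff_eq, intervalIntegral.integral_of_le (neg_le_self Real.pi_pos.le), enorm_smul,
    one_div, Real.enorm_of_nonneg (by positivity)]
  gcongr
  refine (enorm_integral_le_lintegral_enorm _).trans_eq (lintegral_congr fun ξ => ?_)
  have : ‖Complex.exp (-((j : ℂ) * (ξ : ℂ)) * Complex.I)‖ₑ = 1 := by
    have := Complex.norm_exp_ofReal_mul_I (-(j * ξ))
    rw [← ofReal_norm]
    simp only [Complex.ofReal_neg, Complex.ofReal_mul, Complex.ofReal_intCast] at this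
    rw [this, ENNReal.ofReal_one]
  rw [enorm_mul, this, one_mul]

/-- Both spatial norms are controlled by the same weighted `L²` norm in Fourier space; the weight
`1 + (ξ / h)²` is what the Cauchy–Schwarz inequality requires for the supremum norm. -/
theorem gridNorm_sq_le {D : ℝ → ℂ} (hD : Continuous D) {h : ℝ} (hh : 0 < h) {p : ℝ≥0∞}
    (hp : p = 2 ∨ p = ∞) :
    gridNorm h p (fun j => (gridCoeff (fun ξ => (h⁻¹ : ℂ) * D ξ) j).re) ^ 2 ≤
      ∫⁻ ξ in Set.Ioc (-Real.pi) Real.pi,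
        ENNReal.ofReal (h⁻¹ * (1 + (ξ / h) ^ 2) * ‖D ξ‖ ^ 2) := by
  have hnorm : ∀ ξ, ‖(h⁻¹ : ℂ) * D ξ‖ = h⁻¹ * ‖D ξ‖ := fun ξ => by
    rw [norm_mul, ← Complex.ofReal_inv, Complex.norm_real, Real.norm_of_nonneg (by positivity)]
  rcases hp with rfl | rfl
  · refine (gridNorm_two_sq_le (continuous_const.mul hD) hh).trans (lintegral_mono fun ξ => ?_)
    refine ENNReal.ofReal_le_ofReal ?_
    simp only [Pi.mul_apply]
    rw [hnorm]
    calc h * (h⁻¹ * ‖D ξ‖) ^ 2 = h⁻¹ * 1 * ‖D ξ‖ ^ 2 := by field_simp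
      _ ≤ _ := by
        gcongr
        linarith [sq_nonneg (ξ / h)]
  · set w : ℝ → ℝ := fun ξ => h⁻¹ * (1 + (ξ / h) ^ 2)⁻¹ with hw
    have hw0 : ∀ ξ, 0 < w ξ := fun ξ => by positivity
    have hwc : Continuous w := by
      refine continuous_const.mul (Continuous.inv₀ (by fun_prop) fun ξ => ?_)
      positivity
    have hwint : ∫⁻ ξ in Set.Ioc (-Real.pi) Real.pi, ENNReal.ofReal (w ξ)
        ≤ ENNReal.ofReal Real.pi := by
      refine (setLIntegral_le_lintegral _ _).trans ?_
      have hi : Integrable w := (integrable_inv_one_add_sq.comp_div hh.ne').const_mul _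
      rw [← ofReal_integral_eq_lintegral_ofReal hi (ae_of_all _ fun ξ => (hw0 ξ).le)]
      refine ENNReal.ofReal_le_ofReal (le_of_eq ?_)
      rw [hw, integral_const_mul, Measure.integral_comp_div (fun x : ℝ => (1 + x ^ 2)⁻¹) h,
        integral_univ_inv_one_add_sq, abs_of_pos hh, smul_eq_mul]
      field_simp
    set X := ∫⁻ ξ in Set.Ioc (-Real.pi) Real.pi,
        ENNReal.ofReal (h⁻¹ * (1 + (ξ / h) ^ 2) * ‖D ξ‖ ^ 2) with hX
    have hcs : (∫⁻ ξ in Set.Ioc (-Real.pi) Real.pi, ‖(h⁻¹ : ℂ) * D ξ‖ₑ) ^ 2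
        ≤ ENNReal.ofReal Real.pi * X := by
      set F : ℝ → ℝ≥0∞ := fun ξ => ENNReal.ofReal (Real.sqrt (w ξ)) with hF
      set G : ℝ → ℝ≥0∞ := fun ξ => ENNReal.ofReal (h⁻¹ * ‖D ξ‖ / Real.sqrt (w ξ)) with hG
      have hFm : Measurable F := by fun_prop
      have hGm : Measurable G := by fun_prop
      have hFG : ∀ ξ, ‖(h⁻¹ : ℂ) * D ξ‖ₑ = (F * G) ξ := fun ξ => by
        have := Real.sqrt_pos.2 (hw0 ξ)
        rw [Pi.mul_apply, hF, hG, ← ENNReal.ofReal_mul this.le, ← ofReal_norm, hnorm]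
        congr 1
        field_simp
      have hF2 : ∀ ξ, F ξ ^ (2 : ℝ) = ENNReal.ofReal (w ξ) := fun ξ => by
        rw [hF, ENNReal.rpow_two, ← ENNReal.ofReal_pow (Real.sqrt_nonneg _),
          Real.sq_sqrt (hw0 ξ).le]
      have hG2 : ∀ ξ, G ξ ^ (2 : ℝ) = ENNReal.ofReal (h⁻¹ * (1 + (ξ / h) ^ 2) * ‖D ξ‖ ^ 2) :=
        fun ξ => by
          rw [hG, ENNReal.rpow_two, ← ENNReal.ofReal_pow (by positivity), div_pow,
            Real.sq_sqrt (hw0 ξ).le]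
          congr 1
          simp only [hw]
          field_simp
      have hH := ENNReal.lintegral_mul_le_Lp_mul_Lq
        (volume.restrict (Set.Ioc (-Real.pi) Real.pi)) Real.HolderConjugate.two_two
        hFm.aemeasurable hGm.aemeasurable
      simp_rw [hF2, hG2, ← hFG] at hH
      calc (∫⁻ ξ in Set.Ioc (-Real.pi) Real.pi, ‖(h⁻¹ : ℂ) * D ξ‖ₑ) ^ 2
          ≤ ((∫⁻ ξ in Set.Ioc (-Real.pi) Real.pi, ENNReal.ofReal (w ξ)) ^ (1 / 2 : ℝ)
              * X ^ (1 / 2 : ℝ)) ^ 2 := by gcongr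
        _ = (∫⁻ ξ in Set.Ioc (-Real.pi) Real.pi, ENNReal.ofReal (w ξ)) * X := by
            rw [mul_pow, ← ENNReal.rpow_two, ← ENNReal.rpow_two, ← ENNReal.rpow_mul,
              ← ENNReal.rpow_mul]
            norm_num
        _ ≤ _ := by gcongr
    calc _ ≤ (ENNReal.ofReal (2 * Real.pi)⁻¹ *
            ∫⁻ ξ in Set.Ioc (-Real.pi) Real.pi, ‖(h⁻¹ : ℂ) * D ξ‖ₑ) ^ 2 := by
          gcongr
          exact gridNorm_top_le h
      _ ≤ ENNReal.ofReal (2 * Real.pi)⁻¹ ^ 2 * (ENNReal.ofReal Real.pi * X) := by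
          rw [mul_pow]; gcongr
      _ = ENNReal.ofReal ((2 * Real.pi)⁻¹ ^ 2 * Real.pi) * X := by
          rw [← mul_assoc, ← ENNReal.ofReal_pow (by positivity),
            ← ENNReal.ofReal_mul (by positivity)]
      _ ≤ 1 * X := by
          gcongr
          rw [ENNReal.ofReal_le_one]
          have h3 := Real.pi_gt_three
          have : (2 * Real.pi)⁻¹ ^ 2 * Real.pi = 1 / (4 * Real.pi) := by field_simp; norm_num
          rw [this, div_le_one (by positivity)]
          linarith
      _ = X := one_mul X

/-! ### Expectations over independent increments -/

lemma lintegral_norm_prod_sub_prod_sq {ν : Measure ℝ} [IsProbabilityMeasure ν] {C G : ℝ → ℂ}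
    (hC : Integrable (fun z => ‖C z‖ ^ 2) ν) (hG : Integrable (fun z => ‖G z‖ ^ 2) ν)
    (hCG : Integrable (fun z => C z * (starRingEnd ℂ) (G z)) ν) (n : ℕ) :
    ∫⁻ x : Fin n → ℝ, ENNReal.ofReal (‖∏ i, C (x i) - ∏ i, G (x i)‖ ^ 2) ∂(Measure.pi fun _ => ν)
      = ENNReal.ofReal ((∫ z, ‖C z‖ ^ 2 ∂ν) ^ n
          - 2 * ((∫ z, C z * (starRingEnd ℂ) (G z) ∂ν) ^ n).re + (∫ z, ‖G z‖ ^ 2 ∂ν) ^ n) := by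
  have e : ∀ x : Fin n → ℝ, ‖∏ i, C (x i) - ∏ i, G (x i)‖ ^ 2 =
      ∏ i, ‖C (x i)‖ ^ 2 - 2 * (∏ i, C (x i) * (starRingEnd ℂ) (G (x i))).re
        + ∏ i, ‖G (x i)‖ ^ 2 := fun x => by
    rw [norm_sub_sq_complex, norm_prod, norm_prod, map_prod, ← Finset.prod_mul_distrib,
      Finset.prod_pow, Finset.prod_pow]
  have i1 : Integrable (fun x : Fin n → ℝ => ∏ i, ‖C (x i)‖ ^ 2) (Measure.pi fun _ => ν) :=
    Integrable.fintype_prod fun _ => hC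
  have i2 : Integrable (fun x : Fin n → ℝ => ∏ i, ‖G (x i)‖ ^ 2) (Measure.pi fun _ => ν) :=
    Integrable.fintype_prod fun _ => hG
  have i3 : Integrable (fun x : Fin n → ℝ => ∏ i, C (x i) * (starRingEnd ℂ) (G (x i)))
      (Measure.pi fun _ => ν) := Integrable.fintype_prod fun _ => hCG
  have i4 : Integrable (fun x : Fin n → ℝ => 2 * (∏ i, C (x i) * (starRingEnd ℂ) (G (x i))).re)
      (Measure.pi fun _ => ν) := i3.re.const_mul 2
  have i5 : Integrable (fun x : Fin n → ℝ => ∏ i, ‖C (x i)‖ ^ 2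
      - 2 * (∏ i, C (x i) * (starRingEnd ℂ) (G (x i))).re) (Measure.pi fun _ => ν) := i1.sub i4
  have i6 : Integrable (fun x : Fin n → ℝ => ‖∏ i, C (x i) - ∏ i, G (x i)‖ ^ 2)
      (Measure.pi fun _ => ν) := by
    simp_rw [e]
    exact i5.add i2
  have hre : ∫ x : Fin n → ℝ, (∏ i, C (x i) * (starRingEnd ℂ) (G (x i))).re
      ∂(Measure.pi fun _ => ν) = ((∫ z, C z * (starRingEnd ℂ) (G z) ∂ν) ^ n).re := by
    have h1 := integral_re i3
    have h2 := integral_fintype_prod_eq_pow (ι := Fin n) (μ := ν)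
      (fun z => C z * (starRingEnd ℂ) (G z))
    rw [Fintype.card_fin] at h2
    rw [← h2]
    exact h1
  rw [← ofReal_integral_eq_lintegral_ofReal i6 (ae_of_all _ fun x => by positivity)]
  simp_rw [e]
  rw [integral_add i5 i2, integral_sub i1 i4, integral_const_mul, hre]
  rw [integral_fintype_prod_eq_pow (ι := Fin n) (μ := ν) fun z => ‖C z‖ ^ 2,
    integral_fintype_prod_eq_pow (ι := Fin n) (μ := ν) fun z => ‖G z‖ ^ 2, Fintype.card_fin]

lemma map_increment {P : Measure Ω} {M : ℝ≥0 → Ω → ℝ} (hM : IsPreBrownianReal M P) {k : ℝ≥0}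
    (hk : 0 < k) (n : ℕ) : P.map (increment M k n) = gaussianReal 0 1 := by
  have h := hM.hasLaw_sub ((n + 1 : ℕ) * k) ((n : ℕ) * k)
  have hd : nndist (((n + 1 : ℕ) * k : ℝ≥0) : ℝ) (((n : ℕ) * k : ℝ≥0) : ℝ) = k := by
    ext
    rw [coe_nndist, Real.dist_eq]
    push_cast
    rw [show ((n : ℝ) + 1) * k - n * k = k by ring]
    exact abs_of_nonneg k.2
  have h2 : P.map (M ((n + 1 : ℕ) * k) - M ((n : ℕ) * k)) = gaussianReal 0 k := by
    rw [h.map_eq]; congr 1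
  have h3 := gaussianReal_map_div_const (μ := 0) (v := k) (Real.sqrt k)
  rw [← h2, AEMeasurable.map_map_of_aemeasurable (by fun_prop) h.aemeasurable] at h3
  have h4 : ((fun x => x / Real.sqrt k) ∘ (M ((n + 1 : ℕ) * k) - M ((n : ℕ) * k)))
      = increment M k n := rfl
  rw [h4] at h3
  rw [h3, zero_div]
  congr 1
  ext
  push_cast
  rw [Real.sq_sqrt (NNReal.coe_nonneg k)]
  exact div_self (by exact_mod_cast hk.ne')

lemma iIndepFun_increment {P : Measure Ω} {M : ℝ≥0 → Ω → ℝ} (hM : IsPreBrownianReal M P)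
    (k : ℝ≥0) (N : ℕ) : iIndepFun (fun (i : Fin N) => increment M k i) P := by
  have h := hM.hasIndepIncrements N (fun i => (i : ℕ) * k) fun i j hij => by
    have : (i : ℕ) ≤ (j : ℕ) := hij
    simp only
    gcongr
  have h2 := h.comp (fun _ x => x / Real.sqrt k) fun _ => by fun_prop
  exact h2

/-- The joint law of the standardised increments is a product of standard Gaussians. -/
lemma map_increments {P : Measure Ω} {M : ℝ≥0 → Ω → ℝ} (hM : IsPreBrownianReal M P) {k : ℝ≥0}
    (hk : 0 < k) (N : ℕ) : P.map (fun ω (i : Fin N) => increment M k i ω)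
      = Measure.pi fun _ => gaussianReal 0 1 := by
  rw [iIndepFun.map_fun_eq_pi_map (f := fun (i : Fin N) => increment M k i)
    (fun i => aemeasurable_increment hM k i) (iIndepFun_increment hM k N)]
  congr 1
  ext i : 1
  exact map_increment hM hk i

lemma prod_symG_increment {P : Measure Ω} {M : ℝ≥0 → Ω → ℝ} (hM : IsPreBrownianReal M P)
    (μ ρ ξ : ℝ) {h : ℝ} (hh : 0 < h) {k T : ℝ≥0} (hk : 0 < k) {N : ℕ} (hN : N * k = T) :
    ∀ᵐ ω ∂P, ∏ i : Fin N, symG μ ρ (Real.sqrt k / h) (Real.sqrt k) ξ (increment M k i ω) =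
      exactMode ((1 - ρ) * T) (μ * T + Real.sqrt ρ * M T ω) h ξ := by
  filter_upwards [hM.eval_zero_ae_eq_zero] with ω hω
  have hκ : 0 < Real.sqrt k := Real.sqrt_pos.2 hk
  have hk2 : (k : ℝ) = Real.sqrt k ^ 2 := (Real.sq_sqrt k.2).symm
  have hsum : ∑ i : Fin N, Real.sqrt k * increment M k i ω = M T ω := by
    rw [Fin.sum_univ_eq_sum_range (fun i => Real.sqrt k * increment M k i ω)]
    have : ∀ i : ℕ, Real.sqrt k * increment M k i ω
        = M ((i + 1 : ℕ) * k) ω - M ((i : ℕ) * k) ω := fun i => by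
      rw [increment]; field_simp
    simp_rw [this]
    rw [Finset.sum_range_sub (fun i : ℕ => M ((i : ℕ) * k) ω), hN]
    simp [hω]
  have hT : (T : ℝ) = N * Real.sqrt k ^ 2 := by rw [← hk2, ← hN]; push_cast; rfl
  simp only [symG, exactMode]
  rw [← Complex.exp_sum, Finset.sum_add_distrib, ← Finset.sum_mul, ← Complex.ofReal_sum,
    ← Complex.ofReal_sum]
  congr 4
  · rw [Finset.sum_const, Finset.card_univ, Fintype.card_fin, nsmul_eq_mul, hT]
    field_simp
  · rw [← Finset.mul_sum, Finset.sum_add_distrib, Finset.sum_const, Finset.card_univ,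
      Fintype.card_fin, nsmul_eq_mul, ← Finset.mul_sum, ← hsum, ← Finset.mul_sum, hT]
    field_simp

lemma lintegral_mode_error {P : Measure Ω} {M : ℝ≥0 → Ω → ℝ} (hM : IsPreBrownianReal M P)
    (μ θ σ ξ : ℝ) {ρ h : ℝ} (hρ0 : 0 ≤ ρ) (hρ1 : ρ < 1) (hh : 0 < h) {k T : ℝ≥0} (hk : 0 < k)
    {N : ℕ} (hN : N * k = T) :
    ∫⁻ ω, ENNReal.ofReal (‖modeProd μ ρ θ σ (Real.sqrt k / h) (Real.sqrt k) N
        (fun m => increment M k m ω) ξ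
        - exactMode ((1 - ρ) * T) (μ * T + Real.sqrt ρ * M T ω) h ξ‖ ^ 2) ∂P =
      ENNReal.ofReal (ampA μ ρ θ σ (Real.sqrt k / h) (Real.sqrt k) ξ ^ N
        - 2 * (ampC μ ρ θ σ (Real.sqrt k / h) (Real.sqrt k) ξ ^ N).re
        + ampG ρ (Real.sqrt k / h) ξ ^ N) := by
  have h1 := lintegral_norm_prod_sub_prod_sq
    (integrable_norm_symC_sq hρ0 μ θ σ (Real.sqrt k / h) (Real.sqrt k) ξ)
    (integrable_norm_symG_sq μ ρ (Real.sqrt k / h) (Real.sqrt k) ξ)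
    (integrable_symC_mul_conj_symG hρ1 μ θ σ (Real.sqrt k / h) (Real.sqrt k) ξ) N
  rw [integral_norm_symG_sq] at h1
  rw [ampA, ampC, ← h1, ← map_increments hM hk N, lintegral_map']
  · refine lintegral_congr_ae ?_
    filter_upwards [prod_symG_increment hM μ ρ ξ hh hk hN] with ω hω
    rw [hω, modeProd, Finset.prod_range]
  · have : Continuous fun x : Fin N → ℝ => ENNReal.ofReal
        (‖∏ i, symC μ ρ θ σ (Real.sqrt k / h) (Real.sqrt k) ξ (x i)
          - ∏ i, symG μ ρ (Real.sqrt k / h) (Real.sqrt k) ξ (x i)‖ ^ 2) := by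
      refine ENNReal.continuous_ofReal.comp ((Continuous.norm (Continuous.sub ?_ ?_)).pow 2)
      · exact continuous_finsetProd _ fun i _ =>
          (continuous_symC μ ρ θ σ _ _ ξ).comp (continuous_apply i)
      · exact continuous_finsetProd _ fun i _ =>
          (continuous_symG μ ρ _ _ ξ).comp (continuous_apply i)
    exact this.measurable.aemeasurable
  · exact aemeasurable_pi_lambda _ fun i => aemeasurable_increment hM k i

lemma integrable_one_add_abs_pow_mul_exp_neg {c : ℝ} (hc : 0 < c) (n : ℕ) :
    Integrable fun x : ℝ => (1 + |x|) ^ n * Real.exp (-c * x ^ 2) := by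
  have h1 : Integrable fun x : ℝ => |x| ^ n * Real.exp (-c * x ^ 2) := by
    have h := (integrable_rpow_mul_exp_neg_mul_sq hc (s := n) (by
      have : (0 : ℝ) ≤ n := n.cast_nonneg
      linarith)).norm
    refine h.congr (ae_of_all _ fun x => ?_)
    simp only [Real.rpow_natCast, norm_mul, norm_pow, Real.norm_eq_abs, Real.abs_exp]
  have h0 : Integrable fun x : ℝ => Real.exp (-c * x ^ 2) := integrable_exp_neg_mul_sq hc
  refine ((h0.add h1).const_mul (2 ^ (n - 1))).mono' (by fun_prop) (ae_of_all _ fun x => ?_)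
  rw [Real.norm_of_nonneg (by positivity)]
  have h2 := add_pow_le (zero_le_one' ℝ) (abs_nonneg x) n
  rw [one_pow] at h2
  calc (1 + |x|) ^ n * Real.exp (-c * x ^ 2)
      ≤ (2 ^ (n - 1) * (1 + |x| ^ n)) * Real.exp (-c * x ^ 2) := by gcongr
    _ = _ := by simp only [Pi.add_apply]; ring

/-! ### Convergence -/

lemma exactSol_eq_gaussDensity {Ω : Type*} (M : ℝ≥0 → Ω → ℝ) (μ ρ : ℝ) (t : ℝ≥0) (x : ℝ) (ω : Ω) :
    exactSol M μ ρ t x ω = gaussDensity ((1 - ρ) * t) (μ * t + Real.sqrt ρ * M t ω) x := by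
  unfold exactSol heatSol gaussDensity
  rw [sub_sub]

/-- The error of the scheme at the final time as a grid function with explicit Fourier transform. -/
lemma schemeSol_sub_exactSol {Ω : Type*} {μ ρ θ σ κ h : ℝ} (hA : ∀ ξ, symA μ ρ θ σ (κ / h) κ ξ ≠ 0)
    (hρ1 : ρ < 1) (hh : 0 < h) {T : ℝ≥0} (hT : 0 < T) (M : ℝ≥0 → Ω → ℝ) (N : ℕ) (z : ℕ → ℝ)
    (ω : Ω) (j : ℤ) :
    schemeSol μ ρ θ σ κ h N z j - exactSol M μ ρ T (j * h) ω =
      (gridCoeff (fun ξ => (h⁻¹ : ℂ) * (modeProd μ ρ θ σ (κ / h) κ N z ξ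
        - aliasedMode ((1 - ρ) * T) (μ * T + Real.sqrt ρ * M T ω) h ξ)) j).re := by
  have hτ : 0 < (1 - ρ) * T := mul_pos (by linarith) hT
  have h1 := gridCoeff_aliasedMode hτ hh (μ * T + Real.sqrt ρ * M T ω) j
  have h2 := gridCoeff_sub (j := j)
    (f := fun ξ => (h⁻¹ : ℂ) * modeProd μ ρ θ σ (κ / h) κ N z ξ)
    (g := fun ξ => (h⁻¹ : ℂ) * aliasedMode ((1 - ρ) * T) (μ * T + Real.sqrt ρ * M T ω) h ξ)
    (continuous_const.mul (continuous_modeProd hA N z))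
    (continuous_const.mul (continuous_aliasedMode hτ hh (μ * T + Real.sqrt ρ * M T ω)))
  rw [exactSol_eq_gaussDensity, schemeSol]
  simp_rw [mul_sub]
  rw [h2, h1, Complex.sub_re, Complex.ofReal_re]

/-- First-order bound in `k` for the mean-square error of the scheme. -/
theorem exists_lintegral_error_le {P : Measure Ω} [IsProbabilityMeasure P] {M : ℝ≥0 → Ω → ℝ}
    (hM : IsPreBrownianReal M P) (μ : ℝ) {ρ θ σ R : ℝ} {T : ℝ≥0} (hρ0 : 0 ≤ ρ) (hρ1 : ρ < 1)
    (hθ : θ ∈ Set.Icc (0 : ℝ) 1) (hT : 0 < T) (hR : 0 < R) (hstab : R ^ 2 * stabFun ρ θ σ < 1) :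
    ∃ C : ℝ≥0, ∃ κ₁ > 0, ∀ (N : ℕ) (k : ℝ≥0) (h : ℝ), 0 < k → Real.sqrt k ≤ κ₁ → N * k = T →
      0 < h → Real.sqrt k / h = R → ∀ p : ℝ≥0∞, (p = 2 ∨ p = ∞) →
      ∫⁻ ω, gridNorm h p (fun j => schemeSol μ ρ θ σ (Real.sqrt k) h N
          (fun m => increment M k m ω) j - exactSol M μ ρ T (j * h) ω) ^ 2 ∂P
        ≤ ((C * k : ℝ≥0) : ℝ≥0∞) ^ 2 := by
  have hT' : (0 : ℝ) < T := hT
  have hτ : 0 < (1 - ρ) * T := mul_pos (by linarith) hT'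
  obtain ⟨K, hK, γ, hγ, κ₁, hκ₁, hmode⟩ :=
    exists_mode_error_le (T := T) μ hρ0 hρ1 hθ hR hstab hT'.le
  obtain ⟨L, hL, halias⟩ := norm_aliasedMode_sub_le hτ
  obtain ⟨c₀, hc₀, hA'⟩ := exists_le_re_symA hR hstab
  set c := min (γ * T) ((1 - ρ) * T / 2) with hc
  have hc0 : 0 < c := lt_min (by positivity) (by positivity)
  set Φ : ℝ → ℝ := fun η => (2 * K + 2 * L ^ 2 / R ^ 4) * ((1 + |η|) ^ 10 * Real.exp (-c * η ^ 2))
    with hΦ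
  have hΦ0 : ∀ η, 0 ≤ Φ η := fun η => by positivity
  have hΦi : Integrable Φ := (integrable_one_add_abs_pow_mul_exp_neg hc0 10).const_mul _
  have hI0 : 0 ≤ ∫ η, Φ η := integral_nonneg hΦ0
  refine ⟨Real.toNNReal (Real.sqrt (∫ η, Φ η)), κ₁, hκ₁,
    fun N k h hk hkκ hN hh hkR p hp => ?_⟩
  set κ := Real.sqrt k with hκ
  have hκ0 : 0 < κ := Real.sqrt_pos.2 hk
  have hk2 : (k : ℝ) = κ ^ 2 := (Real.sq_sqrt k.2).symm
  have hA : ∀ ξ, symA μ ρ θ σ (κ / h) κ ξ ≠ 0 := fun ξ => by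
    rw [hkR]
    exact norm_pos_iff.1 (hc₀.trans_le (le_norm_symA_of_le_re (hA' _ _ _)))
  set s : Ω → ℝ := fun ω => μ * T + Real.sqrt ρ * M T ω with hs
  set X : Ω → ℝ → ℂ := fun ω ξ => modeProd μ ρ θ σ (κ / h) κ N (fun m => increment M k m ω) ξ
    with hX
  set w : ℝ → ℝ := fun ξ => h⁻¹ * (1 + (ξ / h) ^ 2) with hw
  have hw0 : ∀ ξ, 0 ≤ w ξ := fun ξ => by positivity
  set α : ℝ → ℝ := fun ξ => 2 * (L * h ^ 2 * Real.exp (-((1 - ρ) * T / 4) * (ξ / h) ^ 2)) ^ 2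
    with hα
  set Y : Ω → ℝ → ℝ≥0∞ := fun ω ξ => ENNReal.ofReal (w ξ) *
    (2 * ENNReal.ofReal (‖X ω ξ - exactMode ((1 - ρ) * T) (s ω) h ξ‖ ^ 2)
      + ENNReal.ofReal (α ξ)) with hY
  -- Fourier bound for the norm, with the aliased part of the exact solution split off
  have step1 : ∀ ω, gridNorm h p (fun j => schemeSol μ ρ θ σ κ h N
      (fun m => increment M k m ω) j - exactSol M μ ρ T (j * h) ω) ^ 2
      ≤ ∫⁻ ξ in Set.Ioc (-Real.pi) Real.pi, Y ω ξ := by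
    intro ω
    simp_rw [schemeSol_sub_exactSol hA hρ1 hh hT]
    refine (gridNorm_sq_le ((continuous_modeProd hA N _).sub
      (continuous_aliasedMode hτ hh (s ω))) hh hp).trans ?_
    refine setLIntegral_mono' measurableSet_Ioc fun ξ hξ => ?_
    have hξ' : |ξ| ≤ Real.pi := abs_le.2 ⟨hξ.1.le, hξ.2⟩
    have h1 := halias (s ω) h ξ hh hξ'
    have h2 : ‖X ω ξ - aliasedMode ((1 - ρ) * T) (s ω) h ξ‖ ^ 2 ≤
        2 * ‖X ω ξ - exactMode ((1 - ρ) * T) (s ω) h ξ‖ ^ 2 + α ξ := by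
      have h3 : ‖X ω ξ - aliasedMode ((1 - ρ) * T) (s ω) h ξ‖ ≤
          ‖X ω ξ - exactMode ((1 - ρ) * T) (s ω) h ξ‖
            + L * h ^ 2 * Real.exp (-((1 - ρ) * T / 4) * (ξ / h) ^ 2) := by
        have e : X ω ξ - aliasedMode ((1 - ρ) * T) (s ω) h ξ =
            (X ω ξ - exactMode ((1 - ρ) * T) (s ω) h ξ)
              - (aliasedMode ((1 - ρ) * T) (s ω) h ξ - exactMode ((1 - ρ) * T) (s ω) h ξ) := by
          ring
        rw [e]
        exact (norm_sub_le _ _).trans (by gcongr)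
      refine (pow_le_pow_left₀ (norm_nonneg _) h3 2).trans ?_
      simp only [hα]
      nlinarith [sq_nonneg (‖X ω ξ - exactMode ((1 - ρ) * T) (s ω) h ξ‖
        - L * h ^ 2 * Real.exp (-((1 - ρ) * T / 4) * (ξ / h) ^ 2))]
    have h4 : (2 : ℝ≥0∞) = ENNReal.ofReal 2 := by simp
    simp only [hY]
    rw [h4, ← ENNReal.ofReal_mul (by norm_num),
      ← ENNReal.ofReal_add (by positivity) (by positivity),
      ← ENNReal.ofReal_mul (hw0 ξ)]
    exact ENNReal.ofReal_le_ofReal (mul_le_mul_of_nonneg_left h2 (hw0 ξ))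
  -- `Y` is a continuous function of `ξ`, of the increments and of `M T`
  have hmeas : AEMeasurable (Function.uncurry Y)
      (P.prod (volume.restrict (Set.Ioc (-Real.pi) Real.pi))) := by
    have hΨ : Continuous fun q : ((ℕ → ℝ) × ℝ) × ℝ =>
        ‖modeProd μ ρ θ σ (κ / h) κ N q.1.1 q.2
          - exactMode ((1 - ρ) * T) (μ * T + Real.sqrt ρ * q.1.2) h q.2‖ ^ 2 := by
      have hc1 : Continuous fun q : ((ℕ → ℝ) × ℝ) × ℝ => modeProd μ ρ θ σ (κ / h) κ N q.1.1 q.2 :=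
        (continuous_uncurry_modeProd hA N).comp
          (f := fun q : ((ℕ → ℝ) × ℝ) × ℝ => (q.1.1, q.2)) (by fun_prop)
      have hc2 : Continuous fun q : ((ℕ → ℝ) × ℝ) × ℝ =>
          exactMode ((1 - ρ) * T) (μ * T + Real.sqrt ρ * q.1.2) h q.2 := by
        unfold exactMode; fun_prop
      exact (hc1.sub hc2).norm.pow 2
    have hZ : AEMeasurable (fun ω => ((fun m => increment M k m ω : ℕ → ℝ), M T ω)) P :=
      (aemeasurable_pi_lambda _ fun m => aemeasurable_increment hM k m).prodMk (hM.aemeasurable T)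
    have hq : AEMeasurable (fun q : Ω × ℝ =>
        (((fun m => increment M k m q.1 : ℕ → ℝ), M T q.1), q.2))
        (P.prod (volume.restrict (Set.Ioc (-Real.pi) Real.pi))) :=
      (hZ.comp_quasiMeasurePreserving Measure.quasiMeasurePreserving_fst).prodMk
        measurable_snd.aemeasurable
    have h1 := hΨ.measurable.comp_aemeasurable hq
    have hwm : Measurable fun q : Ω × ℝ => ENNReal.ofReal (w q.2) := by fun_prop
    have hαm : Measurable fun q : Ω × ℝ => ENNReal.ofReal (α q.2) := by fun_prop
    exact hwm.aemeasurable.mul ((h1.ennreal_ofReal.const_mul 2).add hαm.aemeasurable)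
  -- the expectation, frequency by frequency; `h⁴ = k² / R⁴` for the aliasing error
  have step2 : ∀ ξ ∈ Set.Ioc (-Real.pi) Real.pi,
      ∫⁻ ω, Y ω ξ ∂P ≤ ENNReal.ofReal (k ^ 2 * (h⁻¹ * Φ (ξ / h))) := by
    intro ξ hξ
    have hξ' : |ξ| ≤ Real.pi := abs_le.2 ⟨hξ.1.le, hξ.2⟩
    have hN' : (N : ℝ) * κ ^ 2 = T := by rw [← hk2, ← hN]; push_cast; rfl
    have hm := hmode N κ ξ hκ0 hkκ hN' hξ'
    have hη : R * ξ / κ = ξ / h := by rw [← hkR]; field_simp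
    rw [hη] at hm
    have hEe := lintegral_mode_error hM μ θ σ ξ hρ0 hρ1 hh hk hN
    rw [← hκ, hkR] at hEe
    have hmm : AEMeasurable (fun ω => ENNReal.ofReal
        (‖X ω ξ - exactMode ((1 - ρ) * T) (s ω) h ξ‖ ^ 2)) P := by
      have hΨ : Continuous fun q : (ℕ → ℝ) × ℝ =>
          ‖modeProd μ ρ θ σ (κ / h) κ N q.1 ξ
            - exactMode ((1 - ρ) * T) (μ * T + Real.sqrt ρ * q.2) h ξ‖ ^ 2 := by
        have hc1 : Continuous fun q : (ℕ → ℝ) × ℝ => modeProd μ ρ θ σ (κ / h) κ N q.1 ξ :=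
          (continuous_uncurry_modeProd hA N).comp
            (f := fun q : (ℕ → ℝ) × ℝ => (q.1, ξ)) (by fun_prop)
        have hc2 : Continuous fun q : (ℕ → ℝ) × ℝ =>
            exactMode ((1 - ρ) * T) (μ * T + Real.sqrt ρ * q.2) h ξ := by
          unfold exactMode; fun_prop
        exact (hc1.sub hc2).norm.pow 2
      have hZ : AEMeasurable (fun ω => ((fun m => increment M k m ω : ℕ → ℝ), M T ω)) P :=
        (aemeasurable_pi_lambda _ fun m => aemeasurable_increment hM k m).prodMk (hM.aemeasurable T)
      exact (hΨ.measurable.comp_aemeasurable hZ).ennreal_ofReal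
    have hE2 : ∫⁻ ω, ENNReal.ofReal (‖X ω ξ - exactMode ((1 - ρ) * T) (s ω) h ξ‖ ^ 2) ∂P ≤
        ENNReal.ofReal (K * κ ^ 4 * ((1 + |ξ / h|) ^ 8 * Real.exp (-γ * (ξ / h) ^ 2 * T))) := by
      simp only [hX, hs, hkR]
      rw [hEe]
      exact ENNReal.ofReal_le_ofReal hm
    have h4 : (2 : ℝ≥0∞) = ENNReal.ofReal 2 := by simp
    simp only [hY]
    rw [lintegral_const_mul' _ _ ENNReal.ofReal_ne_top, lintegral_add_right _ measurable_const,
      lintegral_const_mul' _ _ (by norm_num), lintegral_const, measure_univ, mul_one]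
    refine (mul_le_mul_right (add_le_add_left (mul_le_mul_right hE2 _) _) _).trans ?_
    rw [h4, ← ENNReal.ofReal_mul (by norm_num),
      ← ENNReal.ofReal_add (by positivity) (by positivity),
      ← ENNReal.ofReal_mul (hw0 ξ)]
    refine ENNReal.ofReal_le_ofReal ?_
    set η := ξ / h with hηdef
    have hκh : h ^ 4 = κ ^ 4 / R ^ 4 := by rw [← hkR]; field_simp
    have e1 : Real.exp (-γ * η ^ 2 * T) ≤ Real.exp (-c * η ^ 2) := Real.exp_le_exp.2 <| by
      have := mul_le_mul_of_nonneg_right (min_le_left (γ * T) ((1 - ρ) * T / 2)) (sq_nonneg η)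
      rw [← hc] at this
      linarith
    have e2 : Real.exp (-((1 - ρ) * T / 4) * η ^ 2) ^ 2 ≤ Real.exp (-c * η ^ 2) := by
      rw [← Real.exp_nat_mul]
      refine Real.exp_le_exp.2 ?_
      have := mul_le_mul_of_nonneg_right (min_le_right (γ * T) ((1 - ρ) * T / 2)) (sq_nonneg η)
      rw [← hc] at this
      push_cast
      linarith
    have h1η : 1 ≤ 1 + |η| := by linarith [abs_nonneg η]
    have e3 : 1 + η ^ 2 ≤ (1 + |η|) ^ 2 := by
      rw [← sq_abs η]; nlinarith [abs_nonneg η]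
    have e4 : (1 : ℝ) ≤ (1 + |η|) ^ 8 := one_le_pow₀ h1η
    set E := Real.exp (-c * η ^ 2) with hE
    calc w ξ * (2 * (K * κ ^ 4 * ((1 + |η|) ^ 8 * Real.exp (-γ * η ^ 2 * T))) + α ξ)
        = h⁻¹ * (1 + η ^ 2) * (2 * (K * κ ^ 4 * ((1 + |η|) ^ 8 * Real.exp (-γ * η ^ 2 * T)))
          + 2 * (L ^ 2 * h ^ 4 * (1 * Real.exp (-((1 - ρ) * T / 4) * η ^ 2) ^ 2))) := by
          simp only [hw, hα]; ring
      _ ≤ h⁻¹ * (1 + |η|) ^ 2 * (2 * (K * κ ^ 4 * ((1 + |η|) ^ 8 * E))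
          + 2 * (L ^ 2 * h ^ 4 * ((1 + |η|) ^ 8 * E))) := by
          gcongr
      _ = k ^ 2 * (h⁻¹ * Φ η) := by
          simp only [hΦ]
          rw [hκh, hk2]
          ring
  have hk0 : (0 : ℝ) ≤ k := k.2
  calc ∫⁻ ω, gridNorm h p (fun j => schemeSol μ ρ θ σ κ h N
          (fun m => increment M k m ω) j - exactSol M μ ρ T (j * h) ω) ^ 2 ∂P
      ≤ ∫⁻ ω, (∫⁻ ξ in Set.Ioc (-Real.pi) Real.pi, Y ω ξ) ∂P := lintegral_mono step1
    _ = ∫⁻ ξ in Set.Ioc (-Real.pi) Real.pi, ∫⁻ ω, Y ω ξ ∂P := lintegral_lintegral_swap hmeas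
    _ ≤ ∫⁻ ξ in Set.Ioc (-Real.pi) Real.pi, ENNReal.ofReal (k ^ 2 * (h⁻¹ * Φ (ξ / h))) :=
        setLIntegral_mono' measurableSet_Ioc step2
    _ ≤ ∫⁻ ξ, ENNReal.ofReal (k ^ 2 * (h⁻¹ * Φ (ξ / h))) := setLIntegral_le_lintegral _ _
    _ = ENNReal.ofReal (k ^ 2 * ∫ η, Φ η) := by
        rw [← ofReal_integral_eq_lintegral_ofReal
          (((hΦi.comp_div hh.ne').const_mul h⁻¹).const_mul _) (ae_of_all _ fun ξ => by
            have := hΦ0 (ξ / h)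
            positivity), integral_const_mul, integral_const_mul, Measure.integral_comp_div Φ h,
          abs_of_pos hh, smul_eq_mul, inv_mul_cancel_left₀ hh.ne']
    _ = _ := by
        rw [← ENNReal.ofReal_coe_nnreal, ← ENNReal.ofReal_pow (NNReal.coe_nonneg _)]
        congr 1
        push_cast
        rw [mul_pow, Real.coe_toNNReal _ (Real.sqrt_nonneg _), Real.sq_sqrt hI0]
        ring

end MilsteinSPDE

end

theorem mainTheorem3 {Ω : Type*} [MeasurableSpace Ω] (P : Measure Ω) [IsProbabilityMeasure P]
    (M : ℝ≥0 → Ω → ℝ) (hM : IsBrownianReal M P)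
    (μ ρ θ σ r : ℝ) (T : ℝ≥0) (hρ0 : 0 ≤ ρ) (hρ1 : ρ < 1) (hθ : θ ∈ Set.Icc (0 : ℝ) 1)
    (hT : 0 < T) (hr : 0 < r) (hstab : r * stabFun ρ θ σ < 1) :
    -- the scheme with `N` time steps on `[0, T]` and `k / h² = r` is well defined
    (∀ N : ℕ, 1 ≤ N →
      ∃! V : ℕ → Ω → ℤ → ℝ, IsMilsteinScheme P M μ ρ θ σ (T / N) (meshSize r (T / N)) V) ∧
    -- it converges in mean square, with first order in `k = T / N`
    ∀ V : ℕ → ℕ → Ω → ℤ → ℝ,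
      (∀ N : ℕ, 1 ≤ N →
        IsMilsteinScheme P M μ ρ θ σ (T / N) (meshSize r (T / N)) (V N)) →
      ∀ p : ℝ≥0∞, (p = 2 ∨ p = ∞) →
        Tendsto (fun N : ℕ => msError P M μ ρ T (meshSize r (T / N)) p (V N N)) atTop (𝓝 0) ∧
        ∃ C : ℝ≥0, ∀ᶠ N : ℕ in atTop,
          msError P M μ ρ T (meshSize r (T / N)) p (V N N) ≤ C * ((T / N : ℝ≥0) : ℝ≥0∞) := by
  have hr0 : 0 < Real.sqrt r := Real.sqrt_pos.2 hr
  have hkpos : ∀ N : ℕ, 1 ≤ N → 0 < T / N := fun N hN => by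
    have : (0 : ℝ≥0) < N := by exact_mod_cast hN
    positivity
  have hkR : ∀ k : ℝ≥0, 0 < k → Real.sqrt k / meshSize r k = Real.sqrt r := fun k hk => by
    have h0 : 0 < Real.sqrt k := Real.sqrt_pos.2 hk
    rw [meshSize, Real.sqrt_div' _ hr.le]
    field_simp
  have hmesh : ∀ k : ℝ≥0, 0 < k → 0 < meshSize r k := fun k hk =>
    Real.sqrt_pos.2 (div_pos hk hr)
  have hstab' : ∀ k : ℝ≥0, 0 < k →
      (Real.sqrt k / meshSize r k) ^ 2 * stabFun ρ θ σ < 1 := fun k hk => by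
    rwa [hkR k hk, Real.sq_sqrt hr.le]
  have hM' : IsPreBrownianReal M P := hM.toIsPreBrownianReal
  refine ⟨fun N hN => ⟨_, isMilsteinScheme_schemeSol hM' μ (hkpos N hN) (hmesh _ (hkpos N hN)) hρ0
    (hstab' _ (hkpos N hN)), fun V hV => ?_⟩, fun V hV p hp => ?_⟩
  · exact hV.eq (hkpos N hN) (hmesh _ (hkpos N hN)) hρ0 (hstab' _ (hkpos N hN))
      (isMilsteinScheme_schemeSol hM' μ (hkpos N hN) (hmesh _ (hkpos N hN)) hρ0
        (hstab' _ (hkpos N hN)))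
  obtain ⟨C, κ₁, hκ₁, hC⟩ := exists_lintegral_error_le hM' μ (R := Real.sqrt r) (σ := σ) hρ0 hρ1 hθ
    hT hr0 (by rwa [Real.sq_sqrt hr.le])
  have hlim : Tendsto (fun N : ℕ => (T / N : ℝ≥0)) atTop (𝓝 0) :=
    tendsto_const_div_atTop_nhds_zero_nat T
  have hlimsqrt : Tendsto (fun N : ℕ => Real.sqrt ((T / N : ℝ≥0) : ℝ)) atTop (𝓝 0) := by
    have h1 := (NNReal.continuous_coe.tendsto 0).comp hlim
    have h2 := (Real.continuous_sqrt.tendsto 0).comp h1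
    rw [Real.sqrt_zero] at h2
    exact h2
  have hbound : ∀ᶠ N : ℕ in atTop,
      msError P M μ ρ T (meshSize r (T / N)) p (V N N) ≤ C * ((T / N : ℝ≥0) : ℝ≥0∞) := by
    filter_upwards [hlimsqrt.eventually_le_const hκ₁, eventually_ge_atTop 1] with N hN hN1
    have hk := hkpos N hN1
    have hNT : (N : ℝ≥0) * (T / N) = T := by
      have : (N : ℝ≥0) ≠ 0 := by exact_mod_cast (by omega : N ≠ 0)
      field_simp
    have hVN := (hV N hN1).eq hk (hmesh _ hk) hρ0 (hstab' _ hk)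
      (isMilsteinScheme_schemeSol hM' μ hk (hmesh _ hk) hρ0 (hstab' _ hk))
    have h := hC N (T / N) _ hk hN hNT (hmesh _ hk) (hkR _ hk) p hp
    rw [msError, hVN]
    calc _ ≤ (((C * (T / N) : ℝ≥0) : ℝ≥0∞) ^ 2) ^ (1 / 2 : ℝ) := by gcongr
      _ = _ := by
          rw [← ENNReal.rpow_two, ← ENNReal.rpow_mul]
          norm_num
  refine ⟨?_, C, hbound⟩
  have hlim2 : Tendsto (fun N : ℕ => (C : ℝ≥0∞) * ((T / N : ℝ≥0) : ℝ≥0∞)) atTop (𝓝 0) := by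
    have h1 : Tendsto (fun N : ℕ => ((T / N : ℝ≥0) : ℝ≥0∞)) atTop (𝓝 0) :=
      ENNReal.tendsto_coe.2 hlim
    simpa using ENNReal.Tendsto.const_mul h1 (Or.inr ENNReal.coe_ne_top)
  exact tendsto_of_tendsto_of_tendsto_of_le_of_le' tendsto_const_nhds hlim2
    (Eventually.of_forall fun _ => zero_le) hbound
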